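/- **Setup.** For real $N>0$ let $X=(X_t)_{t\ge 0}$ be the continuous-time simple random walk on $\mathbb Z^2\cup\{\Delta\}$ that jumps from $x\in\mathbb Z^2$ to each of its four neighbours at rate $\tfrac14$ and to the absorbing cemetery $\Delta$ at rate $N^{-2}$; $P_x$ is its law when $X_0=x$. For finite $K\subset\mathbb Z^2$ let $$\mathrm{cap}_N(K)=\sum_{x\in K}(1+N^{-2})\,P_x(\widetilde H_K=\infty),\qquad \widetilde H_K=\inf\{t>0: X_t\in K \text{ and } X_s\ne X_0\text{ for some }s\in(0,t)\}.$$ For Borel $F\subset\mathbb R^2$ let $\mathrm{cap}^{\tau}_{\mathbb R^2}(F)$ be the capacity of $F$ for planar Brownian motion with variance $\tfrac12$ (per coordinate) at time $1$, killed at an independent exponential time $\tau$ of mean one, that is, $$\big(\mathrm{cap}^{\tau}_{\mathbb R^2}(F)\big)^{-1}=\inf_{\mu}\iint \frac2\pi K_0(2|x-y|)\,d\mu(x)\,d\mu(y),\qquad K_0(s)=\int_0^\infty\frac1{2t}\,e^{-s^2/(4t)-t}\,dt,$$ where $\mu$ ranges over the probability measures on $F$. Identify $[0,1]$ with $[0,1]\times\{0\}\subset\mathbb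 R^2$. Write $|\cdot|$ for the Euclidean norm, $B_r=\{z\in\mathbb Z^2:|z|\le r\}$ and $d(S,S')=\inf\{|x-y|:x\in S,\,y\in S'\}$. **Proposition.** For all $\varepsilon,\delta\in(0,1)$ there exist $c_1\in(0,1)$, $c_2>0$ and $C<\infty$, all depending only on $\varepsilon$ and $\delta$, such that for all real $N\ge C$, all integers $P\in[C,N]$, all $A\subset\{1,\dots,P\}$ with $c_1P\le|A|\le P$, and all families $(S_i)_{i\in A}$ of subsets of $B_{2N}$, the following hold. (i) If $d(S_i,S_j)\ge(|i-j|-\delta)\,N/P$ for all $i\ne j$ in $A$, and if $\kappa>0$ is such that $\mathrm{cap}_N(S_i)\ge\kappa$ for all $i\in A$, then $$\mathrm{cap}_N\Big(\bigcup_{i\in A}S_i\Big)\ \ge\ \Big[(c_2\kappa P)^{-1}+(1+\varepsilon)\big(\mathrm{cap}^{\tau}_{\mathbb R^2}([0,1])\big)^{-1}\Big]^{-1}.$$ (ii) If $|x_1-x_2|\le(|i-j|+1/\delta)\,N/P$ for all $i,j\in A$, $x_1\in S_i$ and $x_2\in S_j$, then $$\mathrm{cap}_N\Big(\bigcup_{i\in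 A}S_i\Big)\ \le\ (1+\varepsilon)\,\mathrm{cap}^{\tau}_{\mathbb R^2}([0,1]).$$ -/

import Mathlib

open MeasureTheory ProbabilityTheory Set
open scoped ENNReal

namespace PorousTube

noncomputable section

/-! ### Euclidean geometry of the lattice -/

/-- The plane `ℝ²` with its Euclidean distance. -/
abbrev Plane : Type := EuclideanSpace ℝ (Fin 2)

/-- The inclusion `ℤ² ⊂ ℝ²`. -/
def toPlane (z : ℤ × ℤ) : Plane := !₂[(z.1 : ℝ), (z.2 : ℝ)]

/-- The Euclidean distance `|x - y|` of two lattice points. -/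
def eucl (x y : ℤ × ℤ) : ℝ := dist (toPlane x) (toPlane y)

/-- The closed Euclidean ball `B_r = {z ∈ ℤ² : |z| ≤ r}`. -/
def latticeBall (r : ℝ) : Set (ℤ × ℤ) := {z | eucl z 0 ≤ r}

/-- `d(A, B) = inf {|a - b| : a ∈ A, b ∈ B}`, with `inf ∅ = ∞`. -/
def setDist (A B : Set (ℤ × ℤ)) : ℝ≥0∞ :=
  ⨅ (a ∈ A) (b ∈ B), ENNReal.ofReal (eucl a b)

/-! ### The walk on `ℤ² ∪ {Δ}` with unit jump rate and killing rate `N⁻²`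

The cemetery `Δ` is `none`. The generator is
`L f(x) = ∑_{y ∼ x} (f(y) - f(x)) / 4 - N⁻² f(x)`. The total rate out of any `x ∈ ℤ²` is
`1 + N⁻²`, so the chain is built from independent exponential clocks of that rate and from
independent jumps: to each neighbour with probability `(1/4) / (1 + N⁻²)` and to `Δ` with
probability `N⁻² / (1 + N⁻²)`. -/

/-- The total rate `λ_x = 1 + N⁻²`. -/
def totalRate (N : ℝ) : ℝ := 1 + (N ^ 2)⁻¹

lemma totalRate_pos (N : ℝ) : 0 < totalRate N := by
  unfold totalRate
  positivity

/-- The four unit vectors. -/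
def unitSteps : Finset (ℤ × ℤ) := {(1, 0), (-1, 0), (0, 1), (0, -1)}

instance : MeasurableSpace (Option (ℤ × ℤ)) := ⊤

/-- The law of one jump: `some e` is a jump by the unit vector `e`, `none` a jump to `Δ`. -/
def stepLaw (N : ℝ) : Measure (Option (ℤ × ℤ)) :=
  ENNReal.ofReal ((N ^ 2)⁻¹ / totalRate N) • Measure.dirac none +
    ∑ e ∈ unitSteps, ENNReal.ofReal ((1 / 4) / totalRate N) • Measure.dirac (some e)

instance (N : ℝ) : IsProbabilityMeasure (stepLaw N) := by
  constructor
  have h := totalRate_pos N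
  have hc : unitSteps.card = 4 := rfl
  simp only [stepLaw, Measure.coe_add, Measure.coe_smul, Measure.coe_finsetSum, Pi.add_apply,
    Pi.smul_apply, Finset.sum_apply, measure_univ, smul_eq_mul, mul_one, Finset.sum_const, hc]
  rw [← ENNReal.ofReal_nsmul, ← ENNReal.ofReal_add (by positivity) (by positivity),
    ← ENNReal.ofReal_one]
  congr 1
  rw [nsmul_eq_mul]
  field_simp
  unfold totalRate
  push_cast
  ring

/-- The law of one holding time: exponential of rate `1 + N⁻²`. -/
def clockLaw (N : ℝ) : Measure ℝ := expMeasure (totalRate N)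

instance (N : ℝ) : IsProbabilityMeasure (clockLaw N) :=
  isProbabilityMeasure_expMeasure (totalRate_pos N)

/-- The sample space: a sequence of jumps and a sequence of holding times. -/
abbrev Sample : Type := (ℕ → Option (ℤ × ℤ)) × (ℕ → ℝ)

/-- The probability on the sample space: all jumps and all holding times are independent. -/
def walkLaw (N : ℝ) : Measure Sample :=
  (Measure.infinitePi fun _ : ℕ => stepLaw N).prod (Measure.infinitePi fun _ : ℕ => clockLaw N)

/-- The successive states visited by the walk started at `x`; `Δ` is absorbing. -/
def jumpChain (x : ℤ × ℤ) (ξ : ℕ → Option (ℤ × ℤ)) : ℕ → Option (ℤ × ℤ)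
  | 0 => some x
  | n + 1 =>
    match jumpChain x ξ n, ξ n with
    | some z, some e => some (z + e)
    | _, _ => none

/-- The time of the `n`-th jump. -/
def jumpTime (σ : ℕ → ℝ) (n : ℕ) : ℝ := ∑ k ∈ Finset.range n, σ k

open Classical in
/-- The walk `X_t` started at `x`: it sits at the `n`-th visited state during the interval
from the `n`-th to the `(n+1)`-st jump time. -/
def walk (x : ℤ × ℤ) (ω : Sample) (t : ℝ) : Option (ℤ × ℤ) :=
  if h : ∃ n, t < jumpTime ω.2 (n + 1) then jumpChain x ω.1 (Nat.find h) else none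

/-- The hitting time
`H̃_K = inf {t > 0 : X_t ∈ K and X_s ≠ X_0 for some s ∈ (0, t)}`, with `inf ∅ = ∞`. -/
def returnTime (K : Set (ℤ × ℤ)) (x : ℤ × ℤ) (ω : Sample) : EReal :=
  sInf ((fun t : ℝ => (t : EReal)) ''
    {t : ℝ | 0 < t ∧ walk x ω t ∈ some '' K ∧ ∃ s ∈ Ioo 0 t, walk x ω s ≠ walk x ω 0})

/-- The equilibrium measure `e_{K,N}(x) = λ_x P_x(H̃_K = ∞)`, for `x ∈ K`. -/
def equilibrium (N : ℝ) (K : Set (ℤ × ℤ)) (x : ℤ × ℤ) : ℝ≥0∞ :=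
  ENNReal.ofReal (totalRate N) * walkLaw N {ω | returnTime K x ω = ⊤}

/-- The capacity `cap_N(K)`, the total mass of the equilibrium measure of `K`. -/
def capN (N : ℝ) (K : Set (ℤ × ℤ)) : ℝ≥0∞ := ∑' x : K, equilibrium N K x

/-! ### The capacity of killed Brownian motion in the plane -/

/-- The modified Bessel function
`K_0(s) = ∫_0^∞ (2t)⁻¹ exp(-s² / (4t) - t) dt`; in particular `K_0(0) = ∞`. -/
def besselK0 (s : ℝ) : ℝ≥0∞ :=
  ∫⁻ t in Ioi (0 : ℝ), ENNReal.ofReal (1 / (2 * t) * Real.exp (-s ^ 2 / (4 * t) - t))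

/-- The energy `∫∫ (2/π) K_0(2 |x - y|) dμ(x) dμ(y)`. -/
def energy (μ : Measure Plane) : ℝ≥0∞ :=
  ∫⁻ x, ∫⁻ y, ENNReal.ofReal (2 / Real.pi) * besselK0 (2 * dist x y) ∂μ ∂μ

/-- The capacity of `A ⊂ ℝ²` for Brownian motion of variance `1/2` killed at an independent
exponential time of mean one: the inverse of the least energy of a probability measure on `A`. -/
def capBrownian (A : Set Plane) : ℝ≥0∞ :=
  (⨅ (μ : Measure Plane) (_ : IsProbabilityMeasure μ) (_ : μ Aᶜ = 0), energy μ)⁻¹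

/-- The segment `[0,1]`, viewed as `[0,1] × {0} ⊂ ℝ²`. -/
def unitSegment : Set Plane := {z | z 0 ∈ Icc (0 : ℝ) 1 ∧ z 1 = 0}

end

end PorousTube

open MeasureTheory ProbabilityTheory Set
open scoped ENNReal

namespace PorousTube

noncomputable section

/-! Capacity is controlled by energy. The potential of the equilibrium measure is the hitting
probability, which is one on the set, so the energy of this measure equals its mass
(`energy_equil`). Since `green N` is positive semidefinite, Cauchy–Schwarz gives (∑ ν)² ≤ energy(ν)
· cap for every charge ν on the set (`sq_sum_le_energy_mul_cap`).

These energies are compared with Brownian ones. By the local central limit theorem, `green N x` and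
`bessel (|x| / N)` differ by a bounded amount off the origin, and by o(1) as |x| → ∞, both uniformly
in `N`. At the scale of cells of side N/P this becomes a factor 1 ± ε. For cells at small
macroscopic distance, `bessel` is so large (it diverges logarithmically at 0) that bounded errors
are relatively negligible; for the others, additive errors are small compared with `bessel 2`, a
lower bound for the kernel at all relevant distances. The same dichotomy absorbs the shifts by δ or
1/δ and the averaging of the kernel over a cell (`exists_green_le`, `exists_le_green`,
`exists_average_kernelE_le`).

Upper bound: the equilibrium measure of the union puts masses W i on the parts, and its energy,
which is cap, is at least (1 - t) ∑ W i W j b i j with b i j = `bessel ((|i - j| + 1/δ) / P)`.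
Spreading W i uniformly over the i-th cell of (0, 1] gives a measure of mass cap and energy at most
(1 + t) times the same sum, so minEnergy · cap² ≤ (1 + ε) cap.

Lower bound: the test measure is ∑ a i ν i, where ν i is the normalised equilibrium measure of S i
and a i is the mass that a nearly optimal ρ gives to the i-th cell. By `exists_profile`, ρ may be
taken with density at most some constant M. Hence a i ≤ M/P, the self-energies a i²/κ sum to at most
M/(Pκ), which is the term (c₂κP)⁻¹, and the few indices outside A carry little mass. The mutual
energies are at most about the energy of ρ. -/

/-! ### The embedded jump chain -/

/-- The law of the sequence of jumps. -/
def jumpLaw (N : ℝ) : Measure (ℕ → Option (ℤ × ℤ)) := Measure.infinitePi fun _ : ℕ => stepLaw N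

instance (N : ℝ) : IsProbabilityMeasure (jumpLaw N) := by
  unfold jumpLaw; infer_instance

/-- The sequence with first term `a` followed by `ξ`. -/
def consSeq (p : Option (ℤ × ℤ) × (ℕ → Option (ℤ × ℤ))) : ℕ → Option (ℤ × ℤ)
  | 0 => p.1
  | n + 1 => p.2 n

lemma measurable_consSeq : Measurable consSeq := by
  refine measurable_pi_lambda _ fun n => ?_
  cases n with
  | zero => exact measurable_fst
  | succ n => exact (measurable_pi_apply n).comp measurable_snd

/-- The Markov property at the first jump: the sequence of later jumps is independent of the first
one and has the original law. It suffices to compare the masses of cylinders. -/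
lemma map_consSeq (N : ℝ) : ((stepLaw N).prod (jumpLaw N)).map consSeq = jumpLaw N := by
  refine Measure.eq_infinitePi _ fun s t ht => ?_
  rw [Measure.map_apply measurable_consSeq
    (MeasurableSet.pi s.countable_toSet fun i _ => ht i)]
  classical
  -- Unconstrained coordinates are padded by `univ`, so that the index set becomes an initial
  -- segment and the factor of index 0 splits off.
  let T : ℕ → Set (Option (ℤ × ℤ)) := fun i => if i ∈ s then t i else univ
  have hT : ∀ i, MeasurableSet (T i) := fun i => by
    simp only [T]; split_ifs
    exacts [ht i, MeasurableSet.univ]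
  obtain ⟨n, hn⟩ : ∃ n, s ⊆ Finset.range (n + 1) := by
    refine ⟨s.sup id, fun i hi => ?_⟩
    have := Finset.le_sup (f := id) hi
    simp only [id] at this
    exact Finset.mem_range.2 (by omega)
  have h1 : consSeq ⁻¹' (Set.pi s t)
      = T 0 ×ˢ (Set.pi (Finset.range n) fun i => T (i + 1)) := by
    ext ⟨a, ξ⟩
    simp only [mem_preimage, Set.mem_pi, mem_prod, Finset.mem_coe, Finset.mem_range, T]
    constructor
    · intro h
      constructor
      · split_ifs with h0
        exacts [h 0 h0, mem_univ _]
      · intro i hi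
        split_ifs with h0
        exacts [h (i + 1) h0, mem_univ _]
    · rintro ⟨h0, h1⟩ i hi
      cases i with
      | zero => rw [if_pos hi] at h0; exact h0
      | succ i =>
        have := h1 i (by have := Finset.mem_range.1 (hn hi); omega)
        rw [if_pos hi] at this; exact this
  rw [h1, Measure.prod_prod, jumpLaw, Measure.infinitePi_pi _ (fun i _ => hT (i + 1))]
  rw [← Finset.prod_range_succ' (fun i => stepLaw N (T i)) n |>.trans (mul_comm _ _)]
  rw [← Finset.prod_subset hn]
  · exact Finset.prod_congr rfl fun i hi => by simp [T, hi]
  · intro i _ hi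
    simp [T, hi]

lemma jumpChain_consSeq (x : ℤ × ℤ) (a : Option (ℤ × ℤ)) (ξ : ℕ → Option (ℤ × ℤ)) (n : ℕ) :
    jumpChain x (consSeq (a, ξ)) (n + 1) =
      match a with
      | some e => jumpChain (x + e) ξ n
      | none => none := by
  induction n with
  | zero => cases a <;> simp [jumpChain, consSeq]
  | succ n ih =>
    rw [jumpChain, ih]
    cases a with
    | none => rfl
    | some e => rfl

lemma measurable_jumpChain (x : ℤ × ℤ) (n : ℕ) : Measurable fun ξ => jumpChain x ξ n := by
  induction n with
  | zero => exact measurable_const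
  | succ n ih =>
    have h : (fun ξ : ℕ → Option (ℤ × ℤ) => jumpChain x ξ (n + 1)) =
        (fun p : Option (ℤ × ℤ) × Option (ℤ × ℤ) =>
          match p.1, p.2 with
          | some z, some e => some (z + e)
          | _, _ => none) ∘ fun ξ => (jumpChain x ξ n, ξ n) := rfl
    rw [h]
    exact (measurable_of_countable _).comp (ih.prodMk (measurable_pi_apply n))

/-- The event that the chain started at `x` visits `K` at some time `n ≥ 0`. -/
def hitSet (K : Set (ℤ × ℤ)) (x : ℤ × ℤ) : Set (ℕ → Option (ℤ × ℤ)) :=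
  {ξ | ∃ n, jumpChain x ξ n ∈ some '' K}

/-- The event that the chain started at `x` visits `K` at some time `n ≥ 1`. -/
def returnSet (K : Set (ℤ × ℤ)) (x : ℤ × ℤ) : Set (ℕ → Option (ℤ × ℤ)) :=
  {ξ | ∃ n, jumpChain x ξ (n + 1) ∈ some '' K}

lemma measurableSet_returnSet (K : Set (ℤ × ℤ)) (x : ℤ × ℤ) : MeasurableSet (returnSet K x) := by
  have : returnSet K x = ⋃ n, (fun ξ => jumpChain x ξ (n + 1)) ⁻¹' (some '' K) := by
    ext; simp [returnSet]
  rw [this]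
  exact MeasurableSet.iUnion fun n => measurable_jumpChain x (n + 1) trivial

lemma hitSet_of_mem {K : Set (ℤ × ℤ)} {x : ℤ × ℤ} (hx : x ∈ K) : hitSet K x = univ :=
  eq_univ_of_forall fun _ => ⟨0, x, hx, rfl⟩

lemma hitSet_of_notMem {K : Set (ℤ × ℤ)} {x : ℤ × ℤ} (hx : x ∉ K) :
    hitSet K x = returnSet K x := by
  ext ξ
  constructor
  · rintro ⟨n, hn⟩
    cases n with
    | zero =>
      obtain ⟨y, hy, h⟩ := hn
      simp only [jumpChain, Option.some.injEq] at h
      exact absurd (h ▸ hy) hx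
    | succ n => exact ⟨n, hn⟩
  · rintro ⟨n, hn⟩
    exact ⟨n + 1, hn⟩

/-- First-step analysis; a first jump to the absorbing cemetery contributes nothing. -/
lemma jumpLaw_returnSet (N : ℝ) (K : Set (ℤ × ℤ)) (x : ℤ × ℤ) :
    jumpLaw N (returnSet K x) =
      ∑ e ∈ unitSteps, ENNReal.ofReal ((1 / 4) / totalRate N) * jumpLaw N (hitSet K (x + e)) := by
  conv_lhs => rw [← map_consSeq N]
  rw [Measure.map_apply measurable_consSeq (measurableSet_returnSet K x),
    Measure.prod_apply (measurable_consSeq (measurableSet_returnSet K x))]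
  have h : ∀ a, jumpLaw N (Prod.mk a ⁻¹' (consSeq ⁻¹' returnSet K x)) =
      match a with
      | some e => jumpLaw N (hitSet K (x + e))
      | none => 0 := by
    intro a
    cases a with
    | none =>
      simp [returnSet, jumpChain_consSeq]
    | some e =>
      simp [returnSet, hitSet, jumpChain_consSeq]
  simp_rw [h]
  rw [stepLaw, lintegral_add_measure, lintegral_smul_measure, lintegral_dirac,
    lintegral_finsetSum_measure]
  simp [lintegral_smul_measure]

/-! ### Reduction of the return time to the jump chain -/

lemma ae_step (N : ℝ) : ∀ᵐ a ∂stepLaw N, a ≠ some 0 := by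
  rw [ae_iff]
  simp only [ne_eq, not_not, ofPred_eq_eq_singleton, stepLaw, Measure.coe_add, Measure.coe_smul,
    Measure.coe_finsetSum, Pi.add_apply, Pi.smul_apply, Finset.sum_apply]
  simp [unitSteps]

lemma ae_clock (N : ℝ) : ∀ᵐ s ∂clockLaw N, 0 < s := by
  have : clockLaw N (Iic 0) = 0 := by
    have h := cdf_expMeasure_eq (totalRate_pos N) 0
    have : IsProbabilityMeasure (expMeasure (totalRate N)) :=
      isProbabilityMeasure_expMeasure (totalRate_pos N)
    rw [cdf_eq_real] at h
    simp only [le_refl, if_true, mul_zero, neg_zero, Real.exp_zero, sub_self] at h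
    exact (measureReal_eq_zero_iff).1 h
  rw [ae_iff]
  simpa [Iic] using this

lemma jumpTime_succ (σ : ℕ → ℝ) (n : ℕ) : jumpTime σ (n + 1) = jumpTime σ n + σ n :=
  Finset.sum_range_succ _ _

/-- Positive holding times make the jump times strictly increasing, so `Nat.find` in `walk` selects
exactly `n`. -/
lemma walk_eq {x : ℤ × ℤ} {ω : Sample} (hσ : ∀ n, 0 < ω.2 n) {n : ℕ} {t : ℝ}
    (h1 : jumpTime ω.2 n ≤ t) (h2 : t < jumpTime ω.2 (n + 1)) :
    walk x ω t = jumpChain x ω.1 n := by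
  have h : ∃ n, t < jumpTime ω.2 (n + 1) := ⟨n, h2⟩
  classical
  have hmono : StrictMono (jumpTime ω.2) := strictMono_nat_of_lt_succ fun n => by
    rw [jumpTime_succ]; linarith [hσ n]
  have hf : Nat.find h = n := by
    rw [Nat.find_eq_iff]
    refine ⟨h2, fun m hm => ?_⟩
    rw [not_lt]
    exact (hmono.monotone (by omega)).trans h1
  rw [walk, dif_pos h]
  congr 1

/-- Almost surely the holding times are positive and the first jump really moves. On this event the
condition "X has left X₀ before t" means that at least one jump has occurred, so the return time
depends on the jump chain only. -/
lemma returnTime_eq_top_iff (K : Set (ℤ × ℤ)) (x : ℤ × ℤ) {ω : Sample}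
    (hσ : ∀ n, 0 < ω.2 n) (hξ : ω.1 0 ≠ some 0) :
    returnTime K x ω = ⊤ ↔ ω.1 ∉ returnSet K x := by
  have hmono : StrictMono (jumpTime ω.2) := strictMono_nat_of_lt_succ fun n => by
    rw [jumpTime_succ]; linarith [hσ n]
  have h0 : jumpTime ω.2 0 = 0 := by simp [jumpTime]
  have w0 : walk x ω 0 = some x := walk_eq hσ h0.le (by rw [← h0]; exact hmono (by simp))
  rw [returnTime, sInf_eq_top]
  constructor
  · rintro h ⟨n, hn⟩
    -- An interior time of the holding interval of the (n+1)-st state; the first jump time is a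
    -- strictly earlier time at which the walk is away from `x`.
    set t := (jumpTime ω.2 (n + 1) + jumpTime ω.2 (n + 2)) / 2 with ht
    have h12 : jumpTime ω.2 (n + 1) < jumpTime ω.2 (n + 2) := hmono (by omega)
    have h01 : jumpTime ω.2 0 < jumpTime ω.2 1 := hmono (by omega)
    have h1n : jumpTime ω.2 1 ≤ jumpTime ω.2 (n + 1) := hmono.monotone (by omega)
    refine EReal.coe_ne_top t (h _ ⟨t, ⟨by linarith, ?_, jumpTime ω.2 1, ⟨by linarith, by linarith⟩,
      ?_⟩, rfl⟩)
    · rw [walk_eq hσ (n := n + 1) (by linarith) (by show t < jumpTime ω.2 (n + 2); linarith)]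
      exact hn
    · rw [walk_eq hσ (n := 1) le_rfl (hmono (by omega)), w0]
      simp only [jumpChain]
      cases hc : ω.1 0 with
      | none => simp
      | some e =>
        intro h
        simp only [Option.some.injEq, add_eq_left] at h
        exact hξ (by rw [hc, h])
  · rintro h _ ⟨t, ⟨ht, hK, s, hs, hne⟩, rfl⟩
    exfalso
    rw [w0] at hne
    by_cases hex : ∃ n, t < jumpTime ω.2 (n + 1)
    · rw [walk, dif_pos hex] at hK
      rcases Nat.eq_zero_or_pos (Nat.find hex) with hz | hp
      · have h1 := Nat.find_spec hex
        rw [hz] at h1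
        exact hne (walk_eq hσ (n := 0) (by rw [h0]; exact hs.1.le) (by linarith [hs.2]))
      · obtain ⟨m, hm⟩ : ∃ m, Nat.find hex = m + 1 := ⟨Nat.find hex - 1, by omega⟩
        rw [hm] at hK
        exact h ⟨m, hK⟩
    -- Beyond all jump times `walk` takes its default value `none`, which is not in `K`;
    -- non-explosion need not be proved.
    · rw [walk, dif_neg hex] at hK
      simp at hK

lemma walkLaw_returnTime (N : ℝ) (K : Set (ℤ × ℤ)) (x : ℤ × ℤ) :
    walkLaw N {ω | returnTime K x ω = ⊤} = jumpLaw N (returnSet K x)ᶜ := by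
  have hclock : ∀ᵐ σ ∂(Measure.infinitePi fun _ : ℕ => clockLaw N), ∀ n, 0 < σ n := by
    rw [ae_all_iff]
    intro n
    exact (measurePreserving_eval_infinitePi (fun _ : ℕ => clockLaw N) n).quasiMeasurePreserving.ae
      (ae_clock N)
  have hstep : ∀ᵐ ξ ∂jumpLaw N, ξ 0 ≠ some 0 :=
    (measurePreserving_eval_infinitePi (fun _ : ℕ => stepLaw N) 0).quasiMeasurePreserving.ae
      (ae_step N)
  have h1 : ∀ᵐ ω ∂walkLaw N, ∀ n, 0 < ω.2 n :=
    Measure.quasiMeasurePreserving_snd.ae hclock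
  have h2 : ∀ᵐ ω ∂walkLaw N, ω.1 0 ≠ some 0 :=
    Measure.quasiMeasurePreserving_fst.ae hstep
  have h3 : {ω | returnTime K x ω = ⊤} =ᵐ[walkLaw N] (returnSet K x)ᶜ ×ˢ (univ : Set (ℕ → ℝ)) := by
    rw [Filter.eventuallyEq_set]
    filter_upwards [h1, h2] with ω ha hb
    have := returnTime_eq_top_iff K x ha hb
    simpa [mem_prod] using this
  rw [measure_congr h3, walkLaw, Measure.prod_prod, measure_univ, mul_one]
  rfl

/-- The probability that the walk started at `x` visits `K`. -/
def hitProb (N : ℝ) (K : Set (ℤ × ℤ)) (x : ℤ × ℤ) : ℝ := (jumpLaw N).real (hitSet K x)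

open Classical in
/-- The equilibrium measure as a real function on `ℤ²`, extended by zero. -/
def equil (N : ℝ) (K : Set (ℤ × ℤ)) (x : ℤ × ℤ) : ℝ :=
  if x ∈ K then totalRate N * (1 - (jumpLaw N).real (returnSet K x)) else 0

lemma equil_nonneg (N : ℝ) (K : Set (ℤ × ℤ)) (x : ℤ × ℤ) : 0 ≤ equil N K x := by
  unfold equil
  split_ifs
  · have := measureReal_le_one (μ := jumpLaw N) (s := returnSet K x)
    have := totalRate_pos N
    exact mul_nonneg this.le (by linarith)
  · exact le_rfl

lemma hitProb_of_mem (N : ℝ) {K : Set (ℤ × ℤ)} {x : ℤ × ℤ} (hx : x ∈ K) : hitProb N K x = 1 := by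
  simp [hitProb, hitSet_of_mem hx]

lemma hitProb_mem_Icc (N : ℝ) (K : Set (ℤ × ℤ)) (x : ℤ × ℤ) : hitProb N K x ∈ Icc (0 : ℝ) 1 :=
  ⟨measureReal_nonneg, measureReal_le_one⟩

lemma real_returnSet (N : ℝ) (K : Set (ℤ × ℤ)) (x : ℤ × ℤ) :
    totalRate N * (jumpLaw N).real (returnSet K x) =
      (1 / 4) * ∑ e ∈ unitSteps, hitProb N K (x + e) := by
  have h := totalRate_pos N
  rw [measureReal_def, jumpLaw_returnSet, ENNReal.toReal_sum fun e _ =>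
    ENNReal.mul_ne_top ENNReal.ofReal_ne_top (measure_ne_top _ _)]
  simp only [ENNReal.toReal_mul]
  rw [ENNReal.toReal_ofReal (by positivity), ← Finset.mul_sum]
  simp only [hitProb, measureReal_def]
  field_simp

/-- The hitting probability solves the Poisson equation with source the equilibrium measure. -/
lemma hitProb_poisson (N : ℝ) (K : Set (ℤ × ℤ)) (x : ℤ × ℤ) :
    totalRate N * hitProb N K x - (1 / 4) * ∑ e ∈ unitSteps, hitProb N K (x + e)
      = equil N K x := by
  rw [← real_returnSet]
  by_cases hx : x ∈ K
  · rw [hitProb_of_mem N hx, equil, if_pos hx]; ring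
  · rw [equil, if_neg hx, hitProb, hitSet_of_notMem hx, sub_self]

/-- The bridge from the defining extended-real series to the finite real sums in which all energy
estimates are done. -/
lemma capN_eq_sum (N : ℝ) (K : Finset (ℤ × ℤ)) :
    capN N (K : Set (ℤ × ℤ)) = ENNReal.ofReal (∑ x ∈ K, equil N K x) := by
  rw [ENNReal.ofReal_sum_of_nonneg fun x _ => equil_nonneg _ _ _, capN,
    Finset.tsum_subtype' K (equilibrium N K)]
  refine Finset.sum_congr rfl fun x hx => ?_
  rw [equilibrium, walkLaw_returnTime, equil, if_pos (by exact_mod_cast hx),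
    ENNReal.ofReal_mul (totalRate_pos N).le, ← probReal_compl_eq_one_sub
      (measurableSet_returnSet _ x), ofReal_measureReal]

/-! ### The heat kernel of the walk on `ℤ` -/

/-- The heat kernel at time `t` of the walk on `ℤ` that jumps to each neighbour at rate `1/4`,
as a Fourier integral. -/
def heat (t : ℝ) (k : ℤ) : ℝ :=
  (2 * Real.pi)⁻¹ * ∫ θ in (-Real.pi)..Real.pi,
    Real.cos (k * θ) * Real.exp (-(t / 2) * (1 - Real.cos θ))

lemma heat_neg (t : ℝ) (k : ℤ) : heat t (-k) = heat t k := by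
  simp [heat]

lemma heat_zero (k : ℤ) : heat 0 k = if k = 0 then 1 else 0 := by
  unfold heat
  split_ifs with hk
  · subst hk
    simp
    field_simp
    ring
  · have hk' : (k : ℝ) ≠ 0 := by exact_mod_cast hk
    have := intervalIntegral.integral_comp_mul_left (a := -Real.pi) (b := Real.pi) Real.cos hk'
    simp [this, Real.sin_int_mul_pi]

lemma abs_heat_integrand_le (k : ℤ) {t : ℝ} (ht : 0 ≤ t) (θ : ℝ) :
    ‖Real.cos (k * θ) * Real.exp (-(t / 2) * (1 - Real.cos θ))‖ ≤ 1 := by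
  rw [norm_mul, Real.norm_eq_abs, Real.norm_eq_abs, Real.abs_exp]
  refine mul_le_one₀ (Real.abs_cos_le_one _) (Real.exp_pos _).le (Real.exp_le_one_iff.2 ?_)
  nlinarith [Real.cos_le_one θ]

lemma abs_heat_le_one {t : ℝ} (ht : 0 ≤ t) (k : ℤ) : |heat t k| ≤ 1 := by
  have h := intervalIntegral.norm_integral_le_of_norm_le_const (a := -Real.pi) (b := Real.pi)
    (fun θ _ => abs_heat_integrand_le k ht θ)
  have hp := Real.pi_pos
  rw [heat, abs_mul, abs_of_pos (by positivity)]
  rw [Real.norm_eq_abs, abs_of_pos (by linarith : 0 < Real.pi - -Real.pi)] at h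
  calc _ ≤ (2 * Real.pi)⁻¹ * (1 * (Real.pi - -Real.pi)) := by gcongr
    _ = 1 := by field_simp; ring

/-- The Kolmogorov equation, by differentiation under the Fourier integral: the multiplier -(1 - cos
θ)/2 acts on cos(kθ) as the generator, by the addition formulas. -/
lemma hasDerivAt_heat (t : ℝ) (k : ℤ) :
    HasDerivAt (fun s => heat s k)
      (1 / 4 * (heat t (k - 1) + heat t (k + 1)) - 1 / 2 * heat t k) t := by
  have key := intervalIntegral.hasDerivAt_integral_of_dominated_loc_of_deriv_le
    (μ := volume) (a := -Real.pi) (b := Real.pi) (x₀ := t) (s := Metric.ball t 1)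
    (F := fun s θ => Real.cos (k * θ) * Real.exp (-(s / 2) * (1 - Real.cos θ)))
    (F' := fun s θ => Real.cos (k * θ) *
      (Real.exp (-(s / 2) * (1 - Real.cos θ)) * (-(1 / 2) * (1 - Real.cos θ))))
    (bound := fun _ => Real.exp (|t| + 1))
    (Metric.ball_mem_nhds t one_pos)
    (Filter.Eventually.of_forall fun s => (by fun_prop : Continuous _).aestronglyMeasurable)
    ((by fun_prop : Continuous _).intervalIntegrable _ _)
    ((by fun_prop : Continuous _).aestronglyMeasurable)
    (Filter.Eventually.of_forall fun θ _ s hs => by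
      rw [norm_mul, norm_mul, Real.norm_eq_abs, Real.norm_eq_abs, Real.norm_eq_abs, Real.abs_exp]
      have h1 := Real.abs_cos_le_one (k * θ)
      have h2 : |(-(1 / 2) * (1 - Real.cos θ))| ≤ 1 := by
        rw [abs_le]; constructor <;> linarith [Real.cos_le_one θ, Real.neg_one_le_cos θ]
      have h3 : Real.exp (-(s / 2) * (1 - Real.cos θ)) ≤ Real.exp (|t| + 1) := by
        apply Real.exp_le_exp.2
        have : |s| ≤ |t| + 1 := by
          have := abs_sub_abs_le_abs_sub s t
          rw [Metric.mem_ball, Real.dist_eq] at hs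
          linarith
        refine le_trans (le_abs_self _) ?_
        rw [abs_mul, abs_neg, abs_div, abs_two]
        have : |1 - Real.cos θ| ≤ 2 := by
          rw [abs_le]; constructor <;> linarith [Real.cos_le_one θ, Real.neg_one_le_cos θ]
        nlinarith [abs_nonneg s]
      calc _ ≤ 1 * (Real.exp (|t| + 1) * 1) := by gcongr
        _ = _ := by ring)
    (by simp)
    (Filter.Eventually.of_forall fun θ _ s _ => by
      refine HasDerivAt.const_mul _ (HasDerivAt.exp ?_)
      have := (((hasDerivAt_id s).div_const 2).neg).mul_const (1 - Real.cos θ)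
      exact this)
  have h := key.2.const_mul (2 * Real.pi)⁻¹
  refine h.congr_deriv ?_
  unfold heat
  have hi : ∀ j : ℤ, IntervalIntegrable
      (fun θ : ℝ => Real.cos (j * θ) * Real.exp (-(t / 2) * (1 - Real.cos θ))) volume
      (-Real.pi) Real.pi := fun j => (by fun_prop : Continuous _).intervalIntegrable _ _
  have e : ∫ θ in (-Real.pi)..Real.pi, Real.cos (k * θ) *
      (Real.exp (-(t / 2) * (1 - Real.cos θ)) * (-(1 / 2) * (1 - Real.cos θ))) =
      ∫ θ in (-Real.pi)..Real.pi,
        (1 / 4 * (Real.cos ((k - 1 : ℤ) * θ) * Real.exp (-(t / 2) * (1 - Real.cos θ)))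
        + 1 / 4 * (Real.cos ((k + 1 : ℤ) * θ) * Real.exp (-(t / 2) * (1 - Real.cos θ)))
        - 1 / 2 * (Real.cos (k * θ) * Real.exp (-(t / 2) * (1 - Real.cos θ)))) := by
    refine intervalIntegral.integral_congr fun θ _ => ?_
    have e1 : Real.cos (((k - 1 : ℤ) : ℝ) * θ) =
        Real.cos (k * θ) * Real.cos θ + Real.sin (k * θ) * Real.sin θ := by
      rw [← Real.cos_sub]; push_cast; ring_nf
    have e2 : Real.cos (((k + 1 : ℤ) : ℝ) * θ) =
        Real.cos (k * θ) * Real.cos θ - Real.sin (k * θ) * Real.sin θ := by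
      rw [← Real.cos_add]; push_cast; ring_nf
    simp only [e1, e2]
    ring
  rw [e, intervalIntegral.integral_sub (((hi _).const_mul _).add ((hi _).const_mul _))
    ((hi _).const_mul _), intervalIntegral.integral_add ((hi _).const_mul _) ((hi _).const_mul _),
    intervalIntegral.integral_const_mul, intervalIntegral.integral_const_mul,
    intervalIntegral.integral_const_mul]
  ring

lemma continuous_heat (k : ℤ) : Continuous fun t => heat t k :=
  continuous_iff_continuousAt.2 fun t => (hasDerivAt_heat t k).continuousAt

/-- Multiplying a positive semidefinite kernel by the heat kernel keeps it so. -/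
lemma sum_mul_heat_nonneg {ι : Type*} (K : Finset ι) (Q : ι → ι → ℝ)
    (hQ : ∀ ν : ι → ℝ, 0 ≤ ∑ x ∈ K, ∑ y ∈ K, ν x * ν y * Q x y) (f : ι → ℤ) (t : ℝ) (ν : ι → ℝ) :
    0 ≤ ∑ x ∈ K, ∑ y ∈ K, ν x * ν y * (Q x y * heat t (f x - f y)) := by
  have hp := Real.pi_pos
  have hi : ∀ (c : ℝ) (j : ℤ), IntervalIntegrable
      (fun θ : ℝ => c * (Real.cos (j * θ) * Real.exp (-(t / 2) * (1 - Real.cos θ)))) volume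
      (-Real.pi) Real.pi := fun c j => (by fun_prop : Continuous _).intervalIntegrable _ _
  have h : ∑ x ∈ K, ∑ y ∈ K, ν x * ν y * (Q x y * heat t (f x - f y)) =
      (2 * Real.pi)⁻¹ * ∫ θ in (-Real.pi)..Real.pi, ∑ x ∈ K, ∑ y ∈ K, (ν x * ν y * Q x y) *
        (Real.cos ((f x - f y : ℤ) * θ) * Real.exp (-(t / 2) * (1 - Real.cos θ))) := by
    rw [intervalIntegral.integral_finsetSum fun x _ =>
      (by fun_prop : Continuous _).intervalIntegrable _ _, Finset.mul_sum]
    refine Finset.sum_congr rfl fun x _ => ?_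
    rw [intervalIntegral.integral_finsetSum fun y _ => hi _ _, Finset.mul_sum]
    refine Finset.sum_congr rfl fun y _ => ?_
    rw [intervalIntegral.integral_const_mul, heat]
    ring
  rw [h]
  refine mul_nonneg (by positivity) (intervalIntegral.integral_nonneg (by linarith) fun θ _ => ?_)
  have h1 := hQ fun x => ν x * Real.cos (f x * θ)
  have h2 := hQ fun x => ν x * Real.sin (f x * θ)
  -- For fixed θ, expanding cos((f x - f y)θ) gives the form of `Q` at two modulated charges, one
  -- with cosines and one with sines.
  have h3 : ∑ x ∈ K, ∑ y ∈ K, (ν x * ν y * Q x y) *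
        (Real.cos ((f x - f y : ℤ) * θ) * Real.exp (-(t / 2) * (1 - Real.cos θ))) =
      Real.exp (-(t / 2) * (1 - Real.cos θ)) *
        (∑ x ∈ K, ∑ y ∈ K, ν x * Real.cos (f x * θ) * (ν y * Real.cos (f y * θ)) * Q x y +
        ∑ x ∈ K, ∑ y ∈ K, ν x * Real.sin (f x * θ) * (ν y * Real.sin (f y * θ)) * Q x y) := by
    rw [← Finset.sum_add_distrib, Finset.mul_sum]
    refine Finset.sum_congr rfl fun x _ => ?_
    rw [← Finset.sum_add_distrib, Finset.mul_sum]
    refine Finset.sum_congr rfl fun y _ => ?_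
    push_cast
    rw [sub_mul, Real.cos_sub]
    ring
  rw [h3]
  exact mul_nonneg (Real.exp_pos _).le (add_nonneg h1 h2)

/-! ### The Green function -/

/-- The Green function of the killed walk on `ℤ²`. -/
def green (N : ℝ) (x : ℤ × ℤ) : ℝ :=
  ∫ t in Ioi (0 : ℝ), Real.exp (-(N ^ 2)⁻¹ * t) * (heat t x.1 * heat t x.2)

lemma abs_heat_mul_heat_le {t : ℝ} (ht : 0 ≤ t) (x : ℤ × ℤ) : |heat t x.1 * heat t x.2| ≤ 1 := by
  rw [abs_mul]
  exact mul_le_one₀ (abs_heat_le_one ht _) (abs_nonneg _) (abs_heat_le_one ht _)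

lemma integrableOn_green {N : ℝ} (hN : 0 < N) (x : ℤ × ℤ) :
    IntegrableOn (fun t => Real.exp (-(N ^ 2)⁻¹ * t) * (heat t x.1 * heat t x.2)) (Ioi 0) := by
  have h0 : 0 < (N ^ 2)⁻¹ := by positivity
  refine Integrable.mono' (exp_neg_integrableOn_Ioi 0 h0) ?_ ?_
  · have := continuous_heat x.1
    have := continuous_heat x.2
    exact (by fun_prop : Continuous _).aestronglyMeasurable
  · filter_upwards [ae_restrict_mem measurableSet_Ioi] with t ht
    rw [norm_mul, Real.norm_eq_abs, Real.norm_eq_abs, Real.abs_exp]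
    exact mul_le_of_le_one_right (Real.exp_pos _).le (abs_heat_mul_heat_le (le_of_lt ht) x)

lemma abs_green_le {N : ℝ} (hN : 0 < N) (x : ℤ × ℤ) :
    |green N x| ≤ ∫ t in Ioi (0 : ℝ), Real.exp (-(N ^ 2)⁻¹ * t) := by
  have h0 : 0 < (N ^ 2)⁻¹ := by positivity
  rw [← Real.norm_eq_abs]
  refine norm_integral_le_of_norm_le (exp_neg_integrableOn_Ioi 0 h0) ?_
  filter_upwards [ae_restrict_mem measurableSet_Ioi] with t ht
  rw [norm_mul, Real.norm_eq_abs, Real.norm_eq_abs, Real.abs_exp]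
  exact mul_le_of_le_one_right (Real.exp_pos _).le (abs_heat_mul_heat_le (le_of_lt ht) x)

lemma green_neg (N : ℝ) (x : ℤ × ℤ) : green N (-x) = green N x := by
  simp [green, heat_neg]

lemma sum_unitSteps (f : ℤ × ℤ → ℝ) :
    ∑ e ∈ unitSteps, f e = f (1, 0) + f (-1, 0) + f (0, 1) + f (0, -1) := by
  unfold unitSteps
  rw [Finset.sum_insert (by decide), Finset.sum_insert (by decide), Finset.sum_insert (by decide),
    Finset.sum_singleton]
  ring

/-- By the Kolmogorov equation, the left side is minus the integral over (0, ∞) of the time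
derivative of the killed heat kernel. The boundary term at infinity vanishes and the one at 0 is the
Dirac mass `heat_zero`. -/
lemma green_poisson {N : ℝ} (hN : 0 < N) (x : ℤ × ℤ) :
    totalRate N * green N x - (1 / 4) * ∑ e ∈ unitSteps, green N (x + e)
      = if x = 0 then 1 else 0 := by
  have h0 : 0 < (N ^ 2)⁻¹ := by positivity
  set a := (N ^ 2)⁻¹ with ha
  let F : ℤ × ℤ → ℝ → ℝ := fun x t => Real.exp (-a * t) * (heat t x.1 * heat t x.2)
  have hF : ∀ x, IntegrableOn (F x) (Ioi 0) := integrableOn_green hN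
  have hG : ∀ x, green N x = ∫ t in Ioi (0 : ℝ), F x t := fun _ => rfl
  let D : ℝ → ℝ := fun t => 1 / 4 * (F (x + (1, 0)) t + F (x + (-1, 0)) t + F (x + (0, 1)) t
    + F (x + (0, -1)) t) - (1 + a) * F x t
  have hDi : IntegrableOn D (Ioi 0) :=
    (((((hF _).add (hF _)).add (hF _)).add (hF _)).const_mul _).sub ((hF _).const_mul _)
  have hd : ∀ t ∈ Ici (0 : ℝ), HasDerivAt (F x) (D t) t := by
    intro t _
    have h1 := hasDerivAt_heat t x.1
    have h2 := hasDerivAt_heat t x.2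
    have h3 : HasDerivAt (fun t => Real.exp (-a * t)) (Real.exp (-a * t) * (-a)) t := by
      simpa using ((hasDerivAt_id t).const_mul (-a)).exp
    refine (h3.mul (h1.mul h2)).congr_deriv ?_
    simp only [D, F, Prod.fst_add, Prod.snd_add, add_zero, ← sub_eq_add_neg, Pi.mul_apply]
    ring
  have ht : Filter.Tendsto (F x) Filter.atTop (nhds 0) := by
    have he : Filter.Tendsto (fun t : ℝ => Real.exp (-a * t)) Filter.atTop (nhds 0) := by
      refine Real.tendsto_exp_atBot.comp ?_
      exact Filter.tendsto_id.const_mul_atTop_of_neg (by linarith)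
    refine squeeze_zero_norm' ?_ he
    filter_upwards [Filter.eventually_ge_atTop 0] with t ht
    simp only [F]
    rw [norm_mul, Real.norm_eq_abs, Real.norm_eq_abs, Real.abs_exp]
    exact mul_le_of_le_one_right (Real.exp_pos _).le (abs_heat_mul_heat_le ht x)
  have key := integral_Ioi_of_hasDerivAt_of_tendsto' hd hDi ht
  have e : ∫ t in Ioi (0 : ℝ), D t = 1 / 4 * (green N (x + (1, 0)) + green N (x + (-1, 0))
      + green N (x + (0, 1)) + green N (x + (0, -1))) - (1 + a) * green N x := by
    have e4 : ∫ t in Ioi (0 : ℝ), (F (x + (1, 0)) t + F (x + (-1, 0)) t + F (x + (0, 1)) t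
        + F (x + (0, -1)) t) = green N (x + (1, 0)) + green N (x + (-1, 0))
        + green N (x + (0, 1)) + green N (x + (0, -1)) := by
      simp only [hG]
      refine (integral_add (((hF _).add (hF _)).add (hF _)) (hF _)).trans ?_
      refine congrArg (· + _) ?_
      refine (integral_add ((hF _).add (hF _)) (hF _)).trans ?_
      refine congrArg (· + _) ?_
      exact integral_add (hF _) (hF _)
    rw [← e4, hG x, ← integral_const_mul, ← integral_const_mul]
    exact integral_sub (((((hF _).add (hF _)).add (hF _)).add (hF _)).const_mul _)
      ((hF _).const_mul _)
  rw [sum_unitSteps]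
  rw [e] at key
  have h00 : F x 0 = if x = 0 then 1 else 0 := by
    simp only [F, mul_zero, Real.exp_zero, one_mul, heat_zero]
    by_cases h1 : x.1 = 0 <;> by_cases h2 : x.2 = 0 <;> simp [Prod.ext_iff, h1, h2]
  rw [h00] at key
  unfold totalRate
  linarith

/-- A bounded solution of the homogeneous Poisson equation vanishes. -/
lemma eq_zero_of_bounded {N : ℝ} (hN : 0 < N) {u : ℤ × ℤ → ℝ} {B : ℝ} (hB : ∀ x, |u x| ≤ B)
    (hu : ∀ x, totalRate N * u x - (1 / 4) * ∑ e ∈ unitSteps, u (x + e) = 0) (x : ℤ × ℤ) :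
    u x = 0 := by
  have hbdd : BddAbove (range fun x => |u x|) := ⟨B, by rintro _ ⟨x, rfl⟩; exact hB x⟩
  set S := ⨆ x, |u x| with hS
  have hle : ∀ x, |u x| ≤ S := fun x => le_ciSup hbdd x
  have hr := totalRate_pos N
  have hr1 : 1 < totalRate N := by
    unfold totalRate; have : 0 < (N ^ 2)⁻¹ := by positivity
    linarith
  -- The equation makes u(x) an average of its neighbours divided by the total rate, which exceeds
  -- 1, so S ≤ S / `totalRate N`.
  have h1 : ∀ x, |u x| ≤ S / totalRate N := by
    intro x
    rw [le_div_iff₀ hr]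
    have h := hu x
    rw [sum_unitSteps] at h
    have e : |u x| * totalRate N = |totalRate N * u x| := by rw [abs_mul, abs_of_pos hr, mul_comm]
    rw [e, sub_eq_zero.1 h, abs_le]
    have h1 := abs_le.1 (hle (x + (1, 0)))
    have h2 := abs_le.1 (hle (x + (-1, 0)))
    have h3 := abs_le.1 (hle (x + (0, 1)))
    have h4 := abs_le.1 (hle (x + (0, -1)))
    constructor <;> linarith
  have h2 : S ≤ S / totalRate N := ciSup_le h1
  have h3 : S ≤ 0 := by
    rw [le_div_iff₀ hr] at h2
    nlinarith
  exact abs_nonpos_iff.1 ((hle x).trans h3)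

/-- The potential of the equilibrium measure is the hitting probability. -/
lemma sum_green_mul_equil {N : ℝ} (hN : 0 < N) (K : Finset (ℤ × ℤ)) (x : ℤ × ℤ) :
    ∑ y ∈ K, green N (x - y) * equil N K y = hitProb N K x := by
  have hB : ∀ x, |∑ y ∈ K, green N (x - y) * equil N K y - hitProb N K x| ≤
      ∑ y ∈ K, (∫ t in Ioi (0 : ℝ), Real.exp (-(N ^ 2)⁻¹ * t)) * equil N K y + 1 := by
    intro x
    refine (abs_sub _ _).trans (add_le_add ?_ ?_)
    · refine (Finset.abs_sum_le_sum_abs _ _).trans (Finset.sum_le_sum fun y _ => ?_)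
      rw [abs_mul, abs_of_nonneg (equil_nonneg N K y)]
      exact mul_le_mul_of_nonneg_right (abs_green_le hN _) (equil_nonneg N K y)
    · have := hitProb_mem_Icc N K x
      rw [abs_of_nonneg this.1]; exact this.2
  -- Potential and hitting probability are bounded and solve the same Poisson equation, hence
  -- coincide.
  refine sub_eq_zero.1 (eq_zero_of_bounded hN hB (fun x => ?_) x)
  have h1 := hitProb_poisson N K x
  have h2 : totalRate N * ∑ y ∈ K, green N (x - y) * equil N K y -
      (1 / 4) * ∑ e ∈ unitSteps, ∑ y ∈ K, green N (x + e - y) * equil N K y = equil N K x := by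
    rw [Finset.sum_comm, Finset.mul_sum, Finset.mul_sum, ← Finset.sum_sub_distrib]
    have : ∀ y ∈ K, totalRate N * (green N (x - y) * equil N K y) -
        1 / 4 * ∑ e ∈ unitSteps, green N (x + e - y) * equil N K y =
        if x = y then equil N K y else 0 := by
      intro y _
      have := green_poisson hN (x - y)
      rw [← Finset.sum_mul]
      simp only [sub_eq_zero, sub_add_eq_add_sub] at this
      split_ifs at this ⊢ <;> linear_combination equil N K y * this
    rw [Finset.sum_congr rfl this, Finset.sum_ite_eq]
    split_ifs with hx
    · rfl
    · rw [equil, if_neg (by exact_mod_cast hx)]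
  rw [Finset.sum_sub_distrib]
  linarith

/-- At each time the planar heat kernel is a product of two one-dimensional ones; starting from the
constant kernel 1, `sum_mul_heat_nonneg` is applied once per coordinate. -/
lemma sum_green_nonneg {N : ℝ} (hN : 0 < N) (K : Finset (ℤ × ℤ)) (ν : ℤ × ℤ → ℝ) :
    0 ≤ ∑ x ∈ K, ∑ y ∈ K, ν x * ν y * green N (x - y) := by
  have h : ∑ x ∈ K, ∑ y ∈ K, ν x * ν y * green N (x - y) =
      ∫ t in Ioi (0 : ℝ), ∑ x ∈ K, ∑ y ∈ K, ν x * ν y * (Real.exp (-(N ^ 2)⁻¹ * t) *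
        (heat t (x.1 - y.1) * heat t (x.2 - y.2))) := by
    have hi : ∀ x y : ℤ × ℤ, IntegrableOn (fun t => ν x * ν y * (Real.exp (-(N ^ 2)⁻¹ * t) *
        (heat t (x.1 - y.1) * heat t (x.2 - y.2)))) (Ioi 0) := fun x y =>
      (integrableOn_green hN (x - y)).const_mul _
    rw [integral_finsetSum _ fun x _ => integrable_finsetSum _ fun y _ => hi x y]
    refine Finset.sum_congr rfl fun x _ => ?_
    rw [integral_finsetSum _ fun y _ => hi x y]
    refine Finset.sum_congr rfl fun y _ => ?_
    rw [integral_const_mul]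
    rfl
  rw [h]
  refine integral_nonneg fun t => ?_
  have h1 := sum_mul_heat_nonneg K (fun _ _ => (1 : ℝ)) (fun ν => by
    simp only [mul_one]
    rw [← Finset.sum_mul_sum]
    exact mul_self_nonneg _) Prod.fst t
  have h2 := sum_mul_heat_nonneg K _ h1 Prod.snd t ν
  have h3 : ∑ x ∈ K, ∑ y ∈ K, ν x * ν y * (Real.exp (-(N ^ 2)⁻¹ * t) *
        (heat t (x.1 - y.1) * heat t (x.2 - y.2))) = Real.exp (-(N ^ 2)⁻¹ * t) *
      ∑ x ∈ K, ∑ y ∈ K, ν x * ν y * (1 * heat t (x.1 - y.1) * heat t (x.2 - y.2)) := by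
    simp_rw [Finset.mul_sum]
    refine Finset.sum_congr rfl fun x _ => Finset.sum_congr rfl fun y _ => by ring
  simp only [h3]
  exact mul_nonneg (Real.exp_pos _).le h2

/-- The energy of the equilibrium measure is the capacity. -/
lemma energy_equil {N : ℝ} (hN : 0 < N) (K : Finset (ℤ × ℤ)) :
    ∑ x ∈ K, ∑ y ∈ K, equil N K x * equil N K y * green N (x - y) = ∑ x ∈ K, equil N K x := by
  refine Finset.sum_congr rfl fun x hx => ?_
  have h := sum_green_mul_equil hN K x
  rw [hitProb_of_mem N (by exact_mod_cast hx)] at h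
  calc _ = equil N K x * ∑ y ∈ K, green N (x - y) * equil N K y := by
        rw [Finset.mul_sum]; exact Finset.sum_congr rfl fun y _ => by ring
    _ = _ := by rw [h, mul_one]

/-- The variational lower bound for the capacity. -/
lemma sq_sum_le_energy_mul_cap {N : ℝ} (hN : 0 < N) (K : Finset (ℤ × ℤ)) (ν : ℤ × ℤ → ℝ) :
    (∑ x ∈ K, ν x) ^ 2 ≤
      (∑ x ∈ K, ∑ y ∈ K, ν x * ν y * green N (x - y)) * ∑ x ∈ K, equil N K x := by
  have hmix : ∑ x ∈ K, ∑ y ∈ K, ν x * equil N K y * green N (x - y) = ∑ x ∈ K, ν x := by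
    refine Finset.sum_congr rfl fun x hx => ?_
    have h := sum_green_mul_equil hN K x
    rw [hitProb_of_mem N (by exact_mod_cast hx)] at h
    calc _ = ν x * ∑ y ∈ K, green N (x - y) * equil N K y := by
          rw [Finset.mul_sum]; exact Finset.sum_congr rfl fun y _ => by ring
      _ = _ := by rw [h, mul_one]
  have hmix' : ∑ x ∈ K, ∑ y ∈ K, equil N K x * ν y * green N (x - y) = ∑ x ∈ K, ν x := by
    rw [← hmix, Finset.sum_comm]
    refine Finset.sum_congr rfl fun x _ => Finset.sum_congr rfl fun y _ => ?_
    rw [← green_neg, neg_sub]; ring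
  -- The energy of ν - s · (equilibrium measure) is a nonnegative quadratic in `s`, and its
  -- discriminant yields the claim. The mixed energy is the mass of ν because the equilibrium
  -- potential is one on `K`.
  have key : ∀ s : ℝ, 0 ≤ (∑ x ∈ K, equil N K x) * (s * s) + (-2 * ∑ x ∈ K, ν x) * s +
      ∑ x ∈ K, ∑ y ∈ K, ν x * ν y * green N (x - y) := by
    intro s
    have h := sum_green_nonneg hN K fun x => ν x - s * equil N K x
    have e : ∑ x ∈ K, ∑ y ∈ K, (ν x - s * equil N K x) * (ν y - s * equil N K y) * green N (x - y)
        = ∑ x ∈ K, ∑ y ∈ K, ν x * ν y * green N (x - y)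
          - s * ∑ x ∈ K, ∑ y ∈ K, ν x * equil N K y * green N (x - y)
          - s * ∑ x ∈ K, ∑ y ∈ K, equil N K x * ν y * green N (x - y)
          + s * s * ∑ x ∈ K, ∑ y ∈ K, equil N K x * equil N K y * green N (x - y) := by
      simp only [Finset.mul_sum, ← Finset.sum_sub_distrib, ← Finset.sum_add_distrib]
      refine Finset.sum_congr rfl fun x _ => Finset.sum_congr rfl fun y _ => by ring
    rw [e, hmix, hmix', energy_equil hN] at h
    linarith
  have := discrim_le_zero key
  unfold discrim at this
  nlinarith

/-! ### The Green function of killed Brownian motion -/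

/-- The Green function `(2/π) K_0(2r)` of killed Brownian motion, at distance `r`. -/
def bessel (r : ℝ) : ℝ := ∫ t in Ioi (0 : ℝ), Real.exp (-t) * ((Real.pi * t)⁻¹ * Real.exp (-r ^ 2 / t))

lemma planarGauss_le {r t : ℝ} (hr : 0 < r) (ht : 0 < t) :
    (Real.pi * t)⁻¹ * Real.exp (-r ^ 2 / t) ≤ (r ^ 2)⁻¹ := by
  have hy : 0 < r ^ 2 / t := by positivity
  have h1 : r ^ 2 / t * Real.exp (-(r ^ 2 / t)) ≤ 1 := by
    rw [Real.exp_neg, ← div_eq_mul_inv, div_le_one (Real.exp_pos _)]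
    linarith [Real.add_one_le_exp (r ^ 2 / t)]
  have h2 : t⁻¹ * Real.exp (-r ^ 2 / t) ≤ (r ^ 2)⁻¹ := by
    calc t⁻¹ * Real.exp (-r ^ 2 / t)
        = (r ^ 2)⁻¹ * (r ^ 2 / t * Real.exp (-(r ^ 2 / t))) := by
          rw [neg_div]; field_simp
      _ ≤ (r ^ 2)⁻¹ * 1 := by gcongr
      _ = _ := mul_one _
  refine le_trans (mul_le_mul_of_nonneg_right ?_ (Real.exp_pos _).le) h2
  gcongr
  nlinarith [Real.pi_gt_three]

lemma integrableOn_bessel {r a : ℝ} (hr : 0 < r) (ha : 0 < a) :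
    IntegrableOn (fun t => Real.exp (-a * t) * ((Real.pi * t)⁻¹ * Real.exp (-r ^ 2 / t)))
      (Ioi 0) := by
  refine Integrable.mono' ((exp_neg_integrableOn_Ioi 0 ha).mul_const (r ^ 2)⁻¹) ?_ ?_
  · exact (by fun_prop : Measurable _).aestronglyMeasurable
  · filter_upwards [ae_restrict_mem measurableSet_Ioi] with t ht
    have ht : 0 < t := ht
    have hp := Real.pi_pos
    rw [Real.norm_of_nonneg (by positivity)]
    exact mul_le_mul_of_nonneg_left (planarGauss_le hr ht) (Real.exp_pos _).le

lemma bessel_eq (r : ℝ) : bessel r =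
    ∫ t in Ioi (0 : ℝ), Real.exp (-1 * t) * ((Real.pi * t)⁻¹ * Real.exp (-r ^ 2 / t)) := by
  simp [bessel]

/-- Brownian scaling. -/
lemma bessel_div (r : ℝ) {N : ℝ} (hN : 0 < N) : bessel (r / N) =
    ∫ t in Ioi (0 : ℝ),
      Real.exp (-(N ^ 2)⁻¹ * t) * ((Real.pi * t)⁻¹ * Real.exp (-r ^ 2 / t)) := by
  have h := integral_comp_mul_left_Ioi (fun t => Real.exp (-(N ^ 2)⁻¹ * t) *
    ((Real.pi * t)⁻¹ * Real.exp (-r ^ 2 / t))) 0 (b := N ^ 2) (by positivity)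
  rw [mul_zero, smul_eq_mul, inv_mul_eq_div, eq_div_iff (by positivity)] at h
  rw [← h, bessel, mul_comm, ← integral_const_mul]
  refine setIntegral_congr_fun measurableSet_Ioi fun t ht => ?_
  have ht : 0 < t := ht
  have hp := Real.pi_pos
  have e1 : -(N ^ 2)⁻¹ * (N ^ 2 * t) = -t := by field_simp
  have e2 : -(r / N) ^ 2 / t = -r ^ 2 / (N ^ 2 * t) := by field_simp
  simp only [e1, e2]
  field_simp

lemma bessel_nonneg (r : ℝ) : 0 ≤ bessel r := by
  refine setIntegral_nonneg measurableSet_Ioi fun t ht => ?_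
  have ht : 0 < t := ht
  have hp := Real.pi_pos
  positivity

lemma bessel_anti {r s : ℝ} (hr : 0 < r) (hrs : r ≤ s) : bessel s ≤ bessel r := by
  rw [bessel_eq, bessel_eq]
  refine setIntegral_mono_on (integrableOn_bessel (hr.trans_le hrs) one_pos)
    (integrableOn_bessel hr one_pos) measurableSet_Ioi fun t ht => ?_
  have ht : 0 < t := ht
  have hp := Real.pi_pos
  gcongr

lemma bessel_pos {r : ℝ} (hr : 0 < r) : 0 < bessel r := by
  rw [bessel_eq]
  refine (setIntegral_pos_iff_support_of_nonneg_ae ?_ (integrableOn_bessel hr one_pos)).2 ?_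
  · filter_upwards [ae_restrict_mem measurableSet_Ioi] with t ht
    have ht : 0 < t := ht
    have hp := Real.pi_pos
    simp only [Pi.zero_apply]
    positivity
  · have : Ioi (0 : ℝ) ⊆ Function.support (fun t => Real.exp (-1 * t) *
        ((Real.pi * t)⁻¹ * Real.exp (-r ^ 2 / t))) ∩ Ioi 0 := by
      intro t ht
      have ht' : 0 < t := ht
      have hp := Real.pi_pos
      exact ⟨ne_of_gt (by positivity), ht⟩
    exact lt_of_lt_of_le (by simp) (measure_mono this)

/-- A comparison principle for the values of `bessel` at two distances. -/
lemma bessel_sub_le {r a : ℝ} (hr : 0 < r) (ha : 1 ≤ a) {B : ℝ → ℝ}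
    (hB : IntegrableOn B (Ioi 0))
    (h : ∀ t, 0 < t → (Real.pi * t)⁻¹ * (Real.exp (-t) * (1 - Real.exp (-((a ^ 2 - 1) * t)))) ≤ B t) :
    bessel r - bessel (a * r) ≤ ∫ t in Ioi (0 : ℝ), B t := by
  have ha0 : 0 < a := by linarith
  -- By scaling, multiplying the distance by `a` is the same as raising the killing rate from 1 to
  -- a²; only the exponential killing factor then changes.
  have e : bessel (a * r) = ∫ t in Ioi (0 : ℝ),
      Real.exp (-(a ^ 2) * t) * ((Real.pi * t)⁻¹ * Real.exp (-r ^ 2 / t)) := by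
    have := bessel_div r (N := a⁻¹) (by positivity)
    simpa [div_inv_eq_mul, mul_comm r a] using this
  rw [e, bessel_eq, ← integral_sub (integrableOn_bessel hr one_pos)
    (integrableOn_bessel hr (by positivity))]
  refine setIntegral_mono_on ((integrableOn_bessel hr one_pos).sub
    (integrableOn_bessel hr (by positivity))) hB measurableSet_Ioi fun t ht => ?_
  have ht : 0 < t := ht
  refine le_trans ?_ (h t ht)
  have hp := Real.pi_pos
  have e1 : Real.exp (-(a ^ 2) * t) = Real.exp (-t) * Real.exp (-((a ^ 2 - 1) * t)) := by
    rw [← Real.exp_add]; ring_nf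
  have h2 : Real.exp (-((a ^ 2 - 1) * t)) ≤ 1 := by
    apply Real.exp_le_one_iff.2
    have : 0 ≤ (a ^ 2 - 1) * t := mul_nonneg (by nlinarith) ht.le
    linarith
  have h3 : Real.exp (-r ^ 2 / t) ≤ 1 := by
    apply Real.exp_le_one_iff.2
    rw [neg_div]
    have : 0 < r ^ 2 / t := by positivity
    linarith
  rw [e1, neg_one_mul]
  calc _ = (Real.pi * t)⁻¹ * (Real.exp (-t) * (1 - Real.exp (-((a ^ 2 - 1) * t)))) *
        Real.exp (-r ^ 2 / t) := by ring
    _ ≤ _ := mul_le_of_le_one_right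
      (mul_nonneg (by positivity) (mul_nonneg (Real.exp_pos _).le (by linarith))) h3

/-- From 1 - e⁻ˣ ≤ x. The bound does not depend on `r` and is sharp enough for ratios `a` near 1. -/
lemma bessel_sub_le_sq {r a : ℝ} (hr : 0 < r) (ha : 1 ≤ a) :
    bessel r - bessel (a * r) ≤ a ^ 2 - 1 := by
  have hi : IntegrableOn (fun t : ℝ => (a ^ 2 - 1) * Real.exp (-t)) (Ioi 0) := by
    simpa [IntegrableOn] using (exp_neg_integrableOn_Ioi 0 one_pos).const_mul (a ^ 2 - 1)
  have := bessel_sub_le hr ha hi fun t ht => by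
    have hp := Real.pi_gt_three
    have h1 := Real.add_one_le_exp (-((a ^ 2 - 1) * t))
    have h2 : 0 ≤ a ^ 2 - 1 := by nlinarith
    calc _ ≤ (Real.pi * t)⁻¹ * (Real.exp (-t) * ((a ^ 2 - 1) * t)) := by gcongr; linarith
      _ = Real.pi⁻¹ * ((a ^ 2 - 1) * Real.exp (-t)) := by field_simp
      _ ≤ 1 * ((a ^ 2 - 1) * Real.exp (-t)) := by
        gcongr
        exact inv_le_one_of_one_le₀ (by linarith)
      _ = _ := one_mul _
  rwa [integral_const_mul, integral_exp_neg_Ioi_zero, mul_one] at this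

/-- This serves for large ratios. The optimal bound is logarithmic in `a`, but a square root
suffices because |u - v|^(-1/2) is integrable. The key is 1 - exp(-(a² - 1)t) ≤ min(1, a²t) ≤
(a²t)^(1/4), which leaves a Gamma integral. -/
lemma exists_bessel_sub_le_sqrt :
    ∃ C : ℝ, 0 < C ∧ ∀ r a : ℝ, 0 < r → 1 ≤ a → bessel r - bessel (a * r) ≤ C * √a := by
  refine ⟨Real.Gamma (1 / 4), Real.Gamma_pos_of_pos (by norm_num), fun r a hr ha => ?_⟩
  have hc := Real.GammaIntegral_convergent (s := 1 / 4) (by norm_num)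
  have := bessel_sub_le hr ha (hc.const_mul (√a)) fun t ht => by
    have hp := Real.pi_gt_three
    have ha0 : 0 < a := by linarith
    have h2 : 0 ≤ a ^ 2 - 1 := by nlinarith
    have hy : 0 < a ^ 2 * t := by positivity
    have key : 1 - Real.exp (-((a ^ 2 - 1) * t)) ≤ (a ^ 2 * t) ^ (1 / 4 : ℝ) := by
      rcases le_total (a ^ 2 * t) 1 with h | h
      · have h1 := Real.add_one_le_exp (-((a ^ 2 - 1) * t))
        calc 1 - Real.exp (-((a ^ 2 - 1) * t)) ≤ a ^ 2 * t := by nlinarith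
          _ = (a ^ 2 * t) ^ (1 : ℝ) := (Real.rpow_one _).symm
          _ ≤ _ := Real.rpow_le_rpow_of_exponent_ge hy h (by norm_num)
      · have := Real.exp_pos (-((a ^ 2 - 1) * t))
        linarith [Real.one_le_rpow h (by norm_num : (0 : ℝ) ≤ 1 / 4)]
    have e1 : (a ^ 2 * t) ^ (1 / 4 : ℝ) = √a * t ^ (1 / 4 : ℝ) := by
      rw [Real.mul_rpow (by positivity) ht.le, Real.sqrt_eq_rpow, ← Real.rpow_natCast a 2,
        ← Real.rpow_mul ha0.le]
      norm_num
    have e2 : t ^ (1 / 4 - 1 : ℝ) = t ^ (1 / 4 : ℝ) * t⁻¹ := by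
      rw [Real.rpow_sub ht, Real.rpow_one, div_eq_mul_inv]
    calc _ ≤ (Real.pi * t)⁻¹ * (Real.exp (-t) * (√a * t ^ (1 / 4 : ℝ))) := by
          rw [← e1]; gcongr
      _ = Real.pi⁻¹ * (√a * (Real.exp (-t) * t ^ (1 / 4 - 1 : ℝ))) := by
          rw [e2, mul_inv]; ring
      _ ≤ 1 * (√a * (Real.exp (-t) * t ^ (1 / 4 - 1 : ℝ))) := by
        gcongr
        exact inv_le_one_of_one_le₀ (by linarith)
      _ = _ := one_mul _
  rwa [integral_const_mul, ← Real.Gamma_eq_integral (by norm_num), mul_comm (√a)] at this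

/-- The logarithmic divergence at 0: for t in (r², 1] both exponential factors are at least e⁻¹, and
1/t integrates to -2 log r. -/
lemma exists_le_bessel (B : ℝ) : ∃ η : ℝ, 0 < η ∧ η < 1 ∧ ∀ r, 0 < r → r ≤ η → B ≤ bessel r := by
  have hp := Real.pi_pos
  set c := Real.pi⁻¹ * Real.exp (-2) with hc
  have hc0 : 0 < c := by positivity
  have hlow : ∀ r, 0 < r → r < 1 → c * (-(2 * Real.log r)) ≤ bessel r := by
    intro r hr hr1
    have hr2 : r ^ 2 ≤ 1 := by nlinarith
    have h1 : ∫ t in Ioc (r ^ 2) 1, Real.exp (-1 * t) * ((Real.pi * t)⁻¹ * Real.exp (-r ^ 2 / t))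
        ≤ bessel r := by
      rw [bessel_eq]
      refine setIntegral_mono_set (integrableOn_bessel hr one_pos) ?_ ?_
      · filter_upwards [ae_restrict_mem measurableSet_Ioi] with t ht
        have ht : 0 < t := ht
        simp only [Pi.zero_apply]
        positivity
      · refine LE.le.eventuallyLE fun t ht => ?_
        exact lt_trans (by positivity) ht.1
    refine le_trans ?_ h1
    have hinv : IntegrableOn (fun t : ℝ => c * (1 / t)) (Ioc (r ^ 2) 1) := by
      have : IntervalIntegrable (fun t : ℝ => c * (1 / t)) volume (r ^ 2) 1 := by
        refine ContinuousOn.intervalIntegrable fun t ht => ?_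
        rw [uIcc_of_le hr2] at ht
        have : t ≠ 0 := ne_of_gt (lt_of_lt_of_le (by positivity) ht.1)
        exact (continuousAt_const.mul (continuousAt_const.div continuousAt_id this)).continuousWithinAt
      exact (intervalIntegrable_iff_integrableOn_Ioc_of_le hr2).1 this
    have e : c * (-(2 * Real.log r)) = ∫ t in Ioc (r ^ 2) 1, c * (1 / t) := by
      rw [← intervalIntegral.integral_of_le hr2, intervalIntegral.integral_const_mul,
        integral_one_div_of_pos (by positivity) one_pos, one_div, Real.log_inv, Real.log_pow]
      norm_num
    rw [e]
    refine setIntegral_mono_on hinv ((integrableOn_bessel hr one_pos).mono_set ?_)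
      measurableSet_Ioc fun t ht => ?_
    · intro t ht
      exact lt_trans (by positivity) ht.1
    · have ht0 : 0 < t := lt_trans (by positivity) ht.1
      have h2 : Real.exp (-2) ≤ Real.exp (-1 * t) * Real.exp (-r ^ 2 / t) := by
        rw [← Real.exp_add]
        apply Real.exp_le_exp.2
        have : r ^ 2 / t ≤ 1 := (div_le_one ht0).2 ht.1.le
        rw [neg_div]
        linarith [ht.2]
      calc c * (1 / t) = (Real.pi * t)⁻¹ * Real.exp (-2) := by rw [hc]; field_simp
        _ ≤ (Real.pi * t)⁻¹ * (Real.exp (-1 * t) * Real.exp (-r ^ 2 / t)) := by gcongr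
        _ = _ := by ring
  refine ⟨min (Real.exp (-(|B| / (2 * c)))) (1 / 2), by positivity, ?_, fun r hr hle => ?_⟩
  · exact lt_of_le_of_lt (min_le_right _ _) (by norm_num)
  have hr1 : r < 1 := lt_of_le_of_lt (hle.trans (min_le_right _ _)) (by norm_num)
  refine le_trans ?_ (hlow r hr hr1)
  have h1 : Real.log r ≤ -(|B| / (2 * c)) := by
    rw [← Real.log_exp (-(|B| / (2 * c)))]
    exact Real.log_le_log hr (hle.trans (min_le_left _ _))
  have h2 : c * (|B| / (2 * c) * 2) = |B| := by field_simp
  have h3 : c * (|B| / (2 * c) * 2) ≤ c * (-(2 * Real.log r)) := by gcongr; linarith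
  linarith [le_abs_self B]

/-- The kernel of the Brownian energy. -/
def kernelE (r : ℝ) : ℝ≥0∞ := ENNReal.ofReal (2 / Real.pi) * besselK0 (2 * r)

lemma kernelE_eq {r : ℝ} (hr : 0 < r) : kernelE r = ENNReal.ofReal (bessel r) := by
  have hp := Real.pi_pos
  rw [kernelE, besselK0, bessel_eq, ofReal_integral_eq_lintegral_ofReal
    (integrableOn_bessel hr one_pos), ← lintegral_const_mul _ (by fun_prop)]
  · refine setLIntegral_congr_fun measurableSet_Ioi fun t ht => ?_
    have ht : 0 < t := ht
    rw [← ENNReal.ofReal_mul (by positivity)]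
    congr 1
    have : -(2 * r) ^ 2 / (4 * t) - t = -1 * t + -r ^ 2 / t := by field_simp; ring
    rw [this, Real.exp_add]
    field_simp
  · filter_upwards [ae_restrict_mem measurableSet_Ioi] with t ht
    have ht : 0 < t := ht
    simp only [Pi.zero_apply]
    positivity

lemma measurable_kernelE : Measurable kernelE := by
  unfold kernelE besselK0
  refine Measurable.const_mul ?_ _
  exact Measurable.lintegral_prod_right' (f := fun p : ℝ × ℝ => ENNReal.ofReal
    (1 / (2 * p.2) * Real.exp (-(2 * p.1) ^ 2 / (4 * p.2) - p.2))) (by fun_prop)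

lemma kernelE_anti {r s : ℝ} (hr : 0 ≤ r) (hrs : r ≤ s) : kernelE s ≤ kernelE r := by
  unfold kernelE besselK0
  refine mul_le_mul_right (setLIntegral_mono_ae (by fun_prop) ?_) _
  refine Filter.Eventually.of_forall fun t ht => ?_
  have ht : 0 < t := ht
  apply ENNReal.ofReal_le_ofReal
  gcongr

/-! ### The local central limit theorem -/

/-- The Gaussian density of variance `t / 2`. -/
def gauss (t x : ℝ) : ℝ := (√(Real.pi * t))⁻¹ * Real.exp (-x ^ 2 / t)

lemma integrable_cos_mul_gauss {b : ℝ} (hb : 0 < b) (k : ℝ) :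
    Integrable fun θ : ℝ => Real.cos (k * θ) * Real.exp (-b * θ ^ 2) := by
  refine Integrable.mono' (integrable_exp_neg_mul_sq hb)
    (by fun_prop : Continuous _).aestronglyMeasurable (Filter.Eventually.of_forall fun θ => ?_)
  rw [norm_mul, Real.norm_eq_abs, Real.norm_eq_abs, Real.abs_exp]
  exact mul_le_of_le_one_left (Real.exp_pos _).le (Real.abs_cos_le_one _)

lemma integral_cos_mul_gauss {b : ℝ} (hb : 0 < b) (k : ℝ) :
    ∫ θ : ℝ, Real.cos (k * θ) * Real.exp (-b * θ ^ 2) =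
      √(Real.pi / b) * Real.exp (-k ^ 2 / (4 * b)) := by
  have h := fourierIntegral_gaussian (b := (b : ℂ)) (by simpa using hb) (k : ℂ)
  have hre := congrArg Complex.re h
  have hi : Integrable fun x : ℝ =>
      Complex.exp (Complex.I * k * x) * Complex.exp (-(b : ℂ) * x ^ 2) := by
    have := integrable_cexp_quadratic (b := (b : ℂ)) (by simpa using hb) (Complex.I * k) 0
    refine this.congr (Filter.Eventually.of_forall fun x => ?_)
    simp only [add_zero]
    rw [Complex.exp_add, mul_comm]
  have e1 : (∫ x : ℝ, Complex.exp (Complex.I * k * x) * Complex.exp (-(b : ℂ) * x ^ 2)).re =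
      ∫ θ : ℝ, Real.cos (k * θ) * Real.exp (-b * θ ^ 2) := by
    rw [← RCLike.re_eq_complex_re, ← integral_re hi]
    refine integral_congr_ae (Filter.Eventually.of_forall fun x => ?_)
    simp only [RCLike.re_eq_complex_re]
    have a1 : Complex.I * k * x = ((k * x : ℝ) : ℂ) * Complex.I := by push_cast; ring
    have a2 : -(b : ℂ) * x ^ 2 = ((-b * x ^ 2 : ℝ) : ℂ) := by push_cast; ring
    rw [a1, a2, ← Complex.ofReal_exp, Complex.re_mul_ofReal, Complex.exp_ofReal_mul_I_re]
  have e2 : (((Real.pi : ℂ) / b) ^ (1 / 2 : ℂ) * Complex.exp (-(k : ℂ) ^ 2 / (4 * b))).re =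
      √(Real.pi / b) * Real.exp (-k ^ 2 / (4 * b)) := by
    have a1 : ((Real.pi : ℂ) / b) ^ (1 / 2 : ℂ) = ((√(Real.pi / b) : ℝ) : ℂ) := by
      rw [Real.sqrt_eq_rpow, Complex.ofReal_cpow (by positivity)]
      push_cast; rfl
    have a2 : -(k : ℂ) ^ 2 / (4 * b) = ((-k ^ 2 / (4 * b) : ℝ) : ℂ) := by push_cast; ring
    rw [a1, a2, ← Complex.ofReal_exp, ← Complex.ofReal_mul, Complex.ofReal_re]
  rw [e1, e2] at hre
  exact hre

/-- The same Fourier form as `heat`, with θ²/2 in place of 1 - cos θ and the whole line in place of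
one period, so the two can be compared under the integral. -/
lemma gauss_eq_integral {t : ℝ} (ht : 0 < t) (k : ℝ) :
    gauss t k = (2 * Real.pi)⁻¹ * ∫ θ : ℝ, Real.cos (k * θ) * Real.exp (-(t / 4) * θ ^ 2) := by
  have hp := Real.pi_pos
  rw [integral_cos_mul_gauss (by positivity), gauss]
  have e1 : 4 * (t / 4) = t := by ring
  have e2 : √(Real.pi / (t / 4)) = 2 * Real.pi * (√(Real.pi * t))⁻¹ := by
    rw [← Real.sqrt_inv]
    rw [show Real.pi / (t / 4) = (2 * Real.pi) ^ 2 * (Real.pi * t)⁻¹ by field_simp; ring,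
      Real.sqrt_mul (by positivity), Real.sqrt_sq (by positivity)]
  rw [e1, e2]
  field_simp

lemma sq_div_four_sub_le (θ : ℝ) : θ ^ 2 / 4 - (1 - Real.cos θ) / 2 ≤ θ ^ 4 := by
  rcases le_total |θ| 1 with h | h
  · have := (abs_le.1 (Real.cos_bound h)).2
    have e : |θ| ^ 4 = θ ^ 4 := by
      rw [show |θ| ^ 4 = (|θ| ^ 2) ^ 2 by ring, sq_abs]; ring
    rw [e] at this
    nlinarith [pow_nonneg (abs_nonneg θ) 4]
  · have h1 : 1 ≤ θ ^ 2 := by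
      rw [← sq_abs]; nlinarith
    nlinarith [Real.cos_le_one θ]

/-- The exponents differ by at most tθ⁴, and both exponentials are at most exp(-tθ²/10) on the
period. Off the period the bound is trivial, as there tθ⁴ ≥ 1. -/
lemma abs_exp_sub_exp_le {t : ℝ} (ht : 1 ≤ t) (θ : ℝ) :
    |(Ioc (-Real.pi) Real.pi).indicator (fun θ => Real.exp (-(t / 2) * (1 - Real.cos θ))) θ
      - Real.exp (-(t / 4) * θ ^ 2)| ≤ 800 / t * Real.exp (-(t / 20) * θ ^ 2) := by
  have hp := Real.pi_gt_three
  have ht0 : 0 < t := by linarith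
  have hpi2 : Real.pi ^ 2 < 10 := by nlinarith [Real.pi_lt_d2, Real.pi_pos]
  -- Half of the Gaussian decay is spent on the polynomial: with y = tθ²/20, y² ≤ 2eʸ reads t²θ⁴ ≤
  -- 800 eʸ.
  have main : t * θ ^ 4 * Real.exp (-(t / 10) * θ ^ 2) ≤
      800 / t * Real.exp (-(t / 20) * θ ^ 2) := by
    have h1 := Real.quadratic_le_exp_of_nonneg (x := t * θ ^ 2 / 20) (by positivity)
    have h2 : t ^ 2 * θ ^ 4 ≤ 800 * Real.exp (t * θ ^ 2 / 20) := by
      have : 0 ≤ t * θ ^ 2 := by positivity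
      nlinarith
    have e : Real.exp (-(t / 10) * θ ^ 2) =
        (Real.exp (t * θ ^ 2 / 20))⁻¹ * Real.exp (-(t / 20) * θ ^ 2) := by
      rw [← Real.exp_neg, ← Real.exp_add]; ring_nf
    rw [e, ← mul_assoc]
    refine mul_le_mul_of_nonneg_right ?_ (Real.exp_pos _).le
    rw [← div_eq_mul_inv, div_le_div_iff₀ (Real.exp_pos _) ht0]
    nlinarith
  refine le_trans ?_ main
  by_cases hθ : θ ∈ Ioc (-Real.pi) Real.pi
  · rw [indicator_of_mem hθ]
    have habs : |θ| ≤ Real.pi := abs_le.2 ⟨hθ.1.le, hθ.2⟩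
    have h1 : Real.cos θ ≤ 1 - 2 / Real.pi ^ 2 * θ ^ 2 := Real.cos_le_one_sub_mul_cos_sq habs
    have h2 : (1 : ℝ) / 5 ≤ 2 / Real.pi ^ 2 := by
      rw [div_le_div_iff₀ (by norm_num) (by positivity)]; linarith
    have h3 := sq_div_four_sub_le θ
    have h4 := Real.one_sub_sq_div_two_le_cos (x := θ)
    set p := t / 2 * (1 - Real.cos θ) with hpdef
    set q := t / 4 * θ ^ 2 with hqdef
    have hpq : p ≤ q := by rw [hpdef, hqdef]; nlinarith
    have hqp : q - p ≤ t * θ ^ 4 := by rw [hpdef, hqdef]; nlinarith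
    have hp' : t / 10 * θ ^ 2 ≤ p := by
      rw [hpdef]
      have : 1 / 5 * θ ^ 2 ≤ 2 / Real.pi ^ 2 * θ ^ 2 := by gcongr
      nlinarith
    have e1 : -(t / 2) * (1 - Real.cos θ) = -p := by rw [hpdef]; ring
    have e2 : -(t / 4) * θ ^ 2 = -q := by rw [hqdef]; ring
    have e3 : -(t / 10) * θ ^ 2 = -(t / 10 * θ ^ 2) := by ring
    rw [e1, e2, e3, abs_of_nonneg (sub_nonneg.2 (Real.exp_le_exp.2 (by linarith)))]
    have e4 : Real.exp (-q) = Real.exp (-p) * Real.exp (-(q - p)) := by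
      rw [← Real.exp_add]; ring_nf
    have h5 := Real.add_one_le_exp (-(q - p))
    calc Real.exp (-p) - Real.exp (-q) = (1 - Real.exp (-(q - p))) * Real.exp (-p) := by
          rw [e4]; ring
      _ ≤ t * θ ^ 4 * Real.exp (-(t / 10 * θ ^ 2)) := by
        gcongr
        linarith
  · rw [indicator_of_notMem hθ, zero_sub, abs_neg, Real.abs_exp]
    have h1 : 1 ≤ θ ^ 2 := by
      rw [mem_Ioc, not_and_or, not_lt, not_le] at hθ
      rcases hθ with h | h <;> nlinarith
    have h2 : 1 ≤ t * θ ^ 4 := by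
      have : 1 ≤ θ ^ 4 := by nlinarith
      nlinarith
    calc Real.exp (-(t / 4) * θ ^ 2) ≤ 1 * Real.exp (-(t / 10) * θ ^ 2) := by
          rw [one_mul]; apply Real.exp_le_exp.2; nlinarith
      _ ≤ _ := by gcongr

/-- The one-dimensional local central limit theorem. -/
lemma abs_heat_sub_gauss_le {t : ℝ} (ht : 1 ≤ t) (k : ℤ) :
    |heat t k - gauss t k| ≤ 1100 / (t * √t) := by
  have hp := Real.pi_gt_three
  have ht0 : 0 < t := by linarith
  have e : heat t k = (2 * Real.pi)⁻¹ * ∫ θ : ℝ, Real.cos (k * θ) *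
      (Ioc (-Real.pi) Real.pi).indicator (fun θ => Real.exp (-(t / 2) * (1 - Real.cos θ))) θ := by
    rw [heat, intervalIntegral.integral_of_le (by linarith), ← integral_indicator measurableSet_Ioc]
    congr 2
    ext θ
    by_cases h : θ ∈ Ioc (-Real.pi) Real.pi <;> simp [h]
  have hi : Integrable fun θ : ℝ => Real.cos (k * θ) *
      (Ioc (-Real.pi) Real.pi).indicator (fun θ => Real.exp (-(t / 2) * (1 - Real.cos θ))) θ := by
    have : (fun θ : ℝ => Real.cos (k * θ) *
        (Ioc (-Real.pi) Real.pi).indicator (fun θ => Real.exp (-(t / 2) * (1 - Real.cos θ))) θ) =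
        (Ioc (-Real.pi) Real.pi).indicator
          fun θ => Real.cos (k * θ) * Real.exp (-(t / 2) * (1 - Real.cos θ)) := by
      ext θ
      by_cases h : θ ∈ Ioc (-Real.pi) Real.pi <;> simp [h]
    rw [this, integrable_indicator_iff measurableSet_Ioc]
    exact ((by fun_prop : Continuous _).integrableOn_Ioc)
  rw [e, gauss_eq_integral ht0, ← mul_sub, ← integral_sub hi
    (integrable_cos_mul_gauss (by positivity) _), abs_mul, abs_of_pos (by positivity)]
  have hbound : |∫ θ : ℝ, (Real.cos (k * θ) * (Ioc (-Real.pi) Real.pi).indicator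
      (fun θ => Real.exp (-(t / 2) * (1 - Real.cos θ))) θ
        - Real.cos (k * θ) * Real.exp (-(t / 4) * θ ^ 2))| ≤
      ∫ θ : ℝ, 800 / t * Real.exp (-(t / 20) * θ ^ 2) := by
    rw [← Real.norm_eq_abs]
    refine norm_integral_le_of_norm_le ((integrable_exp_neg_mul_sq (by positivity)).const_mul _)
      (Filter.Eventually.of_forall fun θ => ?_)
    rw [← mul_sub, norm_mul, Real.norm_eq_abs, Real.norm_eq_abs]
    exact (mul_le_of_le_one_left (abs_nonneg _) (Real.abs_cos_le_one _)).trans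
      (abs_exp_sub_exp_le ht θ)
  rw [integral_const_mul, integral_gaussian] at hbound
  have hs : √(Real.pi / (t / 20)) ≤ 8 / √t := by
    rw [← Real.sqrt_sq (by norm_num : (0 : ℝ) ≤ 8), ← Real.sqrt_div (by norm_num)]
    apply Real.sqrt_le_sqrt
    rw [div_le_div_iff₀ (by positivity) ht0]
    nlinarith [Real.pi_lt_d2]
  have hst : 0 < √t := Real.sqrt_pos.2 ht0
  calc _ ≤ (2 * Real.pi)⁻¹ * (800 / t * (8 / √t)) := by gcongr; exact hbound.trans (by gcongr)
    _ ≤ (6)⁻¹ * (800 / t * (8 / √t)) := by gcongr; linarith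
    _ = (6400 / 6) / (t * √t) := by field_simp; norm_num
    _ ≤ _ := by gcongr; norm_num

lemma gauss_nonneg (t x : ℝ) : 0 ≤ gauss t x := by unfold gauss; positivity

lemma gauss_le {t : ℝ} (ht : 0 < t) (x : ℝ) : gauss t x ≤ (√t)⁻¹ := by
  have hp := Real.pi_gt_three
  have h1 : Real.exp (-x ^ 2 / t) ≤ 1 := by
    apply Real.exp_le_one_iff.2
    rw [neg_div]
    have : 0 ≤ x ^ 2 / t := by positivity
    linarith
  refine (mul_le_of_le_one_right (by positivity) h1).trans ?_
  gcongr
  nlinarith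

lemma gauss_mul_gauss {t : ℝ} (ht : 0 < t) (x y : ℝ) :
    gauss t x * gauss t y = (Real.pi * t)⁻¹ * Real.exp (-(√(x ^ 2 + y ^ 2)) ^ 2 / t) := by
  have hp := Real.pi_pos
  have h : √(Real.pi * t) * √(Real.pi * t) = Real.pi * t := Real.mul_self_sqrt (by positivity)
  rw [Real.sq_sqrt (by positivity), ← h, mul_inv,
    show -(x ^ 2 + y ^ 2) / t = -x ^ 2 / t + -y ^ 2 / t by ring, Real.exp_add, gauss, gauss]
  ring

/-- The planar local central limit theorem. -/
lemma abs_heat_mul_sub_gauss_mul_le {t : ℝ} (ht : 1 ≤ t) (x : ℤ × ℤ) :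
    |heat t x.1 * heat t x.2 - gauss t x.1 * gauss t x.2| ≤ 1300000 / t ^ 2 := by
  have ht0 : 0 < t := by linarith
  have hst : 0 < √t := Real.sqrt_pos.2 ht0
  have hss : √t * √t = t := Real.mul_self_sqrt ht0.le
  have h1 := abs_heat_sub_gauss_le ht x.1
  have h2 := abs_heat_sub_gauss_le ht x.2
  have g1 := gauss_le ht0 x.1
  have g2 := gauss_le ht0 x.2
  have g1' := gauss_nonneg t x.1
  have g2' := gauss_nonneg t x.2
  have hA : 1100 / (t * √t) ≤ 1100 / √t := by
    gcongr
    nlinarith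
  have e : heat t x.1 * heat t x.2 - gauss t x.1 * gauss t x.2 =
      (heat t x.1 - gauss t x.1) * (heat t x.2 - gauss t x.2)
      + (heat t x.1 - gauss t x.1) * gauss t x.2 + gauss t x.1 * (heat t x.2 - gauss t x.2) := by
    ring
  rw [e]
  have habs := abs_add_three ((heat t x.1 - gauss t x.1) * (heat t x.2 - gauss t x.2))
    ((heat t x.1 - gauss t x.1) * gauss t x.2) (gauss t x.1 * (heat t x.2 - gauss t x.2))
  rw [abs_mul, abs_mul, abs_mul, abs_of_nonneg g1', abs_of_nonneg g2'] at habs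
  calc _ ≤ _ := habs
    _ ≤ 1100 / (t * √t) * (1100 / √t) + 1100 / (t * √t) * (√t)⁻¹ + (√t)⁻¹ * (1100 / (t * √t)) := by
      gcongr
      exact h2.trans hA
    _ = 1212200 / (t * (√t * √t)) := by field_simp; norm_num
    _ ≤ _ := by rw [hss, ← sq]; gcongr; norm_num

/-- A crude off-diagonal bound for short times. -/
lemma abs_mul_abs_heat_le {t : ℝ} (ht : 0 ≤ t) (k : ℤ) : |(k : ℝ)| * |heat t k| ≤ t / 2 := by
  have hp := Real.pi_pos
  -- Integration by parts: this primitive vanishes at ±π because sin(kπ) = 0, which trades the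
  -- factor `k` for t/2.
  have hd : ∀ θ ∈ uIcc (-Real.pi) Real.pi, HasDerivAt
      (fun θ => Real.sin (k * θ) * Real.exp (-(t / 2) * (1 - Real.cos θ)))
      (k * (Real.cos (k * θ) * Real.exp (-(t / 2) * (1 - Real.cos θ)))
        - t / 2 * (Real.sin (k * θ) * Real.sin θ * Real.exp (-(t / 2) * (1 - Real.cos θ)))) θ := by
    intro θ _
    have h1 : HasDerivAt (fun θ : ℝ => Real.sin (k * θ)) (Real.cos (k * θ) * k) θ := by
      simpa using ((hasDerivAt_id θ).const_mul (k : ℝ)).sin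
    have h2 : HasDerivAt (fun θ : ℝ => Real.exp (-(t / 2) * (1 - Real.cos θ)))
        (Real.exp (-(t / 2) * (1 - Real.cos θ)) * (-(t / 2) * Real.sin θ)) θ := by
      have := (((Real.hasDerivAt_cos θ).const_sub 1).const_mul (-(t / 2))).exp
      simpa using this
    refine (h1.mul h2).congr_deriv ?_
    ring
  have hi1 : IntervalIntegrable (fun θ : ℝ =>
      (k : ℝ) * (Real.cos (k * θ) * Real.exp (-(t / 2) * (1 - Real.cos θ)))) volume
      (-Real.pi) Real.pi := (by fun_prop : Continuous _).intervalIntegrable _ _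
  have hi2 : IntervalIntegrable (fun θ : ℝ =>
      t / 2 * (Real.sin (k * θ) * Real.sin θ * Real.exp (-(t / 2) * (1 - Real.cos θ)))) volume
      (-Real.pi) Real.pi := (by fun_prop : Continuous _).intervalIntegrable _ _
  have h := intervalIntegral.integral_eq_sub_of_hasDerivAt hd (hi1.sub hi2)
  rw [intervalIntegral.integral_sub hi1 hi2, intervalIntegral.integral_const_mul,
    intervalIntegral.integral_const_mul] at h
  simp only [mul_neg, Real.sin_neg, Real.sin_int_mul_pi, zero_mul, neg_zero, sub_zero] at h
  have hb : |∫ θ in (-Real.pi)..Real.pi,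
      Real.sin (k * θ) * Real.sin θ * Real.exp (-(t / 2) * (1 - Real.cos θ))| ≤ 2 * Real.pi := by
    have := intervalIntegral.norm_integral_le_of_norm_le_const (a := -Real.pi) (b := Real.pi)
      (C := 1)
      (f := fun θ => Real.sin (k * θ) * Real.sin θ * Real.exp (-(t / 2) * (1 - Real.cos θ)))
      (fun θ _ => by
        rw [norm_mul, norm_mul, Real.norm_eq_abs, Real.norm_eq_abs, Real.norm_eq_abs, Real.abs_exp]
        have h3 : Real.exp (-(t / 2) * (1 - Real.cos θ)) ≤ 1 := by
          apply Real.exp_le_one_iff.2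
          nlinarith [Real.cos_le_one θ]
        exact mul_le_one₀ (mul_le_one₀ (Real.abs_sin_le_one _) (abs_nonneg _)
          (Real.abs_sin_le_one _)) (Real.exp_pos _).le h3)
    rw [Real.norm_eq_abs, abs_of_pos (by linarith : 0 < Real.pi - -Real.pi)] at this
    linarith
  have e : (k : ℝ) * heat t k = (2 * Real.pi)⁻¹ * (t / 2 * ∫ θ in (-Real.pi)..Real.pi,
      Real.sin (k * θ) * Real.sin θ * Real.exp (-(t / 2) * (1 - Real.cos θ))) := by
    rw [← sub_eq_zero.1 h, heat]; ring
  rw [← abs_mul, e, abs_mul, abs_mul, abs_of_pos (by positivity : 0 < (2 * Real.pi)⁻¹),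
    abs_of_nonneg (by linarith : 0 ≤ t / 2)]
  calc _ ≤ (2 * Real.pi)⁻¹ * (t / 2 * (2 * Real.pi)) := by gcongr
    _ = t / 2 := by field_simp

lemma abs_heat_mul_heat_le_div {t : ℝ} (ht : 0 ≤ t) (x : ℤ × ℤ) {r : ℝ} (hr : 0 < r)
    (hx : r = √((x.1 : ℝ) ^ 2 + (x.2 : ℝ) ^ 2)) : |heat t x.1 * heat t x.2| ≤ t / r := by
  have hsq : r ^ 2 = (x.1 : ℝ) ^ 2 + (x.2 : ℝ) ^ 2 := by rw [hx, Real.sq_sqrt (by positivity)]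
  rw [le_div_iff₀ hr, abs_mul]
  have a1 := abs_mul_abs_heat_le ht x.1
  have a2 := abs_mul_abs_heat_le ht x.2
  have b1 := abs_heat_le_one ht x.1
  have b2 := abs_heat_le_one ht x.2
  have c1 := abs_nonneg (heat t x.1)
  have c2 := abs_nonneg (heat t x.2)
  have d1 := abs_nonneg (x.1 : ℝ)
  have d2 := abs_nonneg (x.2 : ℝ)
  have hle : r ≤ |(x.1 : ℝ)| + |(x.2 : ℝ)| := by
    apply le_of_sq_le_sq _ (by positivity)
    rw [hsq, ← sq_abs (x.1 : ℝ), ← sq_abs (x.2 : ℝ)]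
    nlinarith
  calc |heat t x.1| * |heat t x.2| * r
      ≤ |heat t x.1| * |heat t x.2| * (|(x.1 : ℝ)| + |(x.2 : ℝ)|) := by gcongr
    _ = |(x.1 : ℝ)| * |heat t x.1| * |heat t x.2| + |(x.2 : ℝ)| * |heat t x.2| * |heat t x.1| := by
      ring
    _ ≤ t / 2 * 1 + t / 2 * 1 := by gcongr
    _ = t := by ring

/-- The lattice Green function is close to the Brownian one. -/
lemma abs_green_sub_bessel_le {N : ℝ} (hN : 0 < N) (x : ℤ × ℤ) {r T : ℝ} (hr : 1 ≤ r)
    (hx : r = √((x.1 : ℝ) ^ 2 + (x.2 : ℝ) ^ 2)) (hT : 1 ≤ T) :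
    |green N x - bessel (r / N)| ≤ 2 * T ^ 2 / r + 1300000 / T := by
  have hr0 : 0 < r := by linarith
  have hT0 : 0 < T := by linarith
  have ha : 0 < (N ^ 2)⁻¹ := by positivity
  set f : ℝ → ℝ := fun t => Real.exp (-(N ^ 2)⁻¹ * t) * (heat t x.1 * heat t x.2) -
    Real.exp (-(N ^ 2)⁻¹ * t) * ((Real.pi * t)⁻¹ * Real.exp (-r ^ 2 / t)) with hf
  have hfi : IntegrableOn f (Ioi 0) := (integrableOn_green hN x).sub (integrableOn_bessel hr0 ha)
  have e : green N x - bessel (r / N) = ∫ t in Ioi (0 : ℝ), f t := by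
    rw [bessel_div r hN, green, ← integral_sub (integrableOn_green hN x)
      (integrableOn_bessel hr0 ha)]
  have hexp : ∀ t, 0 < t → Real.exp (-(N ^ 2)⁻¹ * t) ≤ 1 := fun t ht => by
    apply Real.exp_le_one_iff.2
    nlinarith
  rw [e, ← Ioc_union_Ioi_eq_Ioi hT0.le, setIntegral_union
    (Ioc_disjoint_Ioi le_rfl) measurableSet_Ioi
    (hfi.mono_set fun t ht => ht.1) (hfi.mono_set fun t ht => hT0.trans ht)]
  -- Up to time `T` each of the two kernels is at most T/r; afterwards the local limit error is of
  -- order t⁻², with tail of order 1/T.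
  refine (abs_add_le _ _).trans (add_le_add ?_ ?_)
  · have := norm_setIntegral_le_of_norm_le_const (μ := volume) (s := Ioc 0 T) (f := f)
      (C := 2 * T / r) (by simp) fun t ht => by
        have ht0 : 0 < t := ht.1
        rw [hf]
        simp only
        rw [← mul_sub, norm_mul, Real.norm_eq_abs, Real.norm_eq_abs, Real.abs_exp]
        refine (mul_le_of_le_one_left (abs_nonneg _) (hexp t ht0)).trans ?_
        refine (abs_sub _ _).trans ?_
        have hp := Real.pi_pos
        have h1 := abs_heat_mul_heat_le_div ht0.le x hr0 hx
        have h2 := planarGauss_le hr0 ht0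
        rw [abs_of_nonneg (by positivity : 0 ≤ (Real.pi * t)⁻¹ * Real.exp (-r ^ 2 / t))]
        have h3 : t / r ≤ T / r := by gcongr; exact ht.2
        have h4 : (r ^ 2)⁻¹ ≤ T / r := by
          rw [inv_eq_one_div, div_le_div_iff₀ (by positivity) hr0]
          nlinarith
        calc _ ≤ T / r + T / r := by linarith
          _ = _ := by ring
    rw [Real.norm_eq_abs] at this
    refine this.trans (le_of_eq ?_)
    rw [measureReal_def, Real.volume_Ioc, ENNReal.toReal_ofReal (by linarith)]
    ring
  · have hInt := integrableOn_Ioi_rpow_of_lt (a := -2) (by norm_num) hT0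
    have hval := integral_Ioi_rpow_of_lt (a := -2) (by norm_num) hT0
    have : ‖∫ t in Ioi T, f t‖ ≤ ∫ t in Ioi T, 1300000 * t ^ (-2 : ℝ) := by
      refine norm_integral_le_of_norm_le (hInt.const_mul _) ?_
      filter_upwards [ae_restrict_mem measurableSet_Ioi] with t ht
      have ht1 : T < t := ht
      have ht0 : 0 < t := by linarith
      rw [hf]
      simp only
      rw [← mul_sub, norm_mul, Real.norm_eq_abs, Real.norm_eq_abs, Real.abs_exp]
      refine (mul_le_of_le_one_left (abs_nonneg _) (hexp t ht0)).trans ?_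
      have h1 := abs_heat_mul_sub_gauss_mul_le (t := t) (by linarith) x
      rw [gauss_mul_gauss ht0, ← hx] at h1
      rw [Real.rpow_neg ht0.le, Real.rpow_two, ← div_eq_mul_inv]
      exact h1
    rw [Real.norm_eq_abs, integral_const_mul, hval] at this
    refine this.trans (le_of_eq ?_)
    norm_num
    rw [Real.rpow_neg_one]
    ring

/-! ### Uniform comparison of the two Green functions -/

/-- The Euclidean norm of a lattice point. -/
def norm2 (x : ℤ × ℤ) : ℝ := √((x.1 : ℝ) ^ 2 + (x.2 : ℝ) ^ 2)

lemma eucl_eq (x y : ℤ × ℤ) : eucl x y = norm2 (x - y) := by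
  simp [eucl, toPlane, norm2, EuclideanSpace.dist_eq, Fin.sum_univ_two, Real.dist_eq, sq_abs]

lemma one_le_norm2 {x : ℤ × ℤ} (hx : x ≠ 0) : 1 ≤ norm2 x := by
  rw [norm2, Real.one_le_sqrt]
  have : 0 < x.1 ^ 2 + x.2 ^ 2 := by
    by_contra h
    have h1 : x.1 ^ 2 = 0 := by nlinarith [sq_nonneg x.1, sq_nonneg x.2]
    have h2 : x.2 ^ 2 = 0 := by nlinarith [sq_nonneg x.1, sq_nonneg x.2]
    exact hx (Prod.ext (pow_eq_zero_iff (by norm_num) |>.1 h1)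
      (pow_eq_zero_iff (by norm_num) |>.1 h2))
  have : (1 : ℤ) ≤ x.1 ^ 2 + x.2 ^ 2 := this
  exact_mod_cast this

lemma norm2_zero : norm2 0 = 0 := by simp [norm2]

/-- A uniform bound on the difference of the two Green functions off the diagonal. -/
lemma exists_abs_green_sub_bessel_le : ∃ K : ℝ, 0 < K ∧ ∀ (N : ℝ) (x : ℤ × ℤ), 0 < N → x ≠ 0 →
    |green N x - bessel (norm2 x / N)| ≤ K := by
  refine ⟨1300002, by norm_num, fun N x hN hx => ?_⟩
  have h1 := one_le_norm2 hx
  refine (abs_green_sub_bessel_le hN x h1 rfl le_rfl).trans ?_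
  have : 2 * 1 ^ 2 / norm2 x ≤ 2 := by rw [div_le_iff₀ (by linarith)]; linarith
  linarith

/-- The two Green functions agree asymptotically at large distances, uniformly in the killing. -/
lemma exists_abs_green_sub_bessel_le_of_far {s : ℝ} (hs : 0 < s) : ∃ R : ℝ, 1 ≤ R ∧
    ∀ (N : ℝ) (x : ℤ × ℤ), 0 < N → R ≤ norm2 x → |green N x - bessel (norm2 x / N)| ≤ s := by
  -- The cutoff makes the tail error at most s/2; the radius chosen next does the same for the
  -- short-time error.
  set T : ℝ := 1 + 2600000 / s with hT
  have hT1 : 1 ≤ T := by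
    have : 0 < 2600000 / s := by positivity
    linarith
  have hT0 : 0 < T := by linarith
  refine ⟨max 1 (4 * T ^ 2 / s), le_max_left _ _, fun N x hN hx => ?_⟩
  have h1 : 1 ≤ norm2 x := (le_max_left _ _).trans hx
  have h2 : 4 * T ^ 2 / s ≤ norm2 x := (le_max_right _ _).trans hx
  refine (abs_green_sub_bessel_le hN x h1 rfl hT1).trans ?_
  have h3 : 2 * T ^ 2 / norm2 x ≤ s / 2 := by
    rw [div_le_iff₀ hs] at h2
    rw [div_le_iff₀ (by linarith)]
    linarith
  have h4 : 1300000 / T ≤ s / 2 := by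
    rw [div_le_iff₀ hT0, hT, mul_add, div_mul_div_comm]
    have : s * 2600000 / (2 * s) = 1300000 := by field_simp; norm_num
    linarith
  linarith

/-- Positive semidefiniteness tested on the charge δ₀ - δ₍₁,₀₎. It reduces the origin, where the
comparison with `bessel` is unavailable, to a neighbour. -/
lemma green_unit_le (N : ℝ) (hN : 0 < N) : green N (1, 0) ≤ green N 0 := by
  have h := sum_green_nonneg hN {0, (1, 0)} fun x => if x = 0 then 1 else -1
  have hne : (0 : ℤ × ℤ) ∉ ({(1, 0)} : Finset (ℤ × ℤ)) := by decide
  have hne' : ((1, 0) : ℤ × ℤ) ≠ 0 := by decide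
  simp only [Finset.sum_insert hne, Finset.sum_singleton, if_true, if_neg hne', sub_self,
    zero_sub, sub_zero, green_neg] at h
  linarith

/-- Upper bound for the lattice Green function between far apart cells. -/
lemma exists_green_le {ε δ : ℝ} (hε : 0 < ε) (hδ : δ ∈ Ioo (0 : ℝ) 1) : ∃ C : ℝ, 0 < C ∧
    ∀ (N : ℝ) (P m : ℕ) (x : ℤ × ℤ), C ≤ P → (P : ℝ) ≤ N → 1 ≤ m → m ≤ P →
      ((m : ℝ) - δ) * N / P ≤ norm2 x → green N x ≤ (1 + ε) * bessel (((m : ℝ) + 1) / P) := by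
  obtain ⟨hδ0, hδ1⟩ := hδ
  obtain ⟨K, hK0, hK⟩ := exists_abs_green_sub_bessel_le
  have h1δ : 0 < 1 - δ := by linarith
  -- `A` bounds the total error for nearby cells: `K` from the lattice, the rest from moving m - δ
  -- to m + 1, whose ratio is at most 2/(1 - δ) for m ≥ 1.
  set A := (2 / (1 - δ)) ^ 2 + K with hA
  have hA0 : 0 < A := by positivity
  obtain ⟨η, hη0, hη1, hη⟩ := exists_le_bessel (A / ε)
  have hb := bessel_pos (r := 2) (by norm_num)
  set s := ε * bessel 2 with hs
  have hs0 : 0 < s := by positivity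
  obtain ⟨R, hR1, hR⟩ := exists_abs_green_sub_bessel_le_of_far (half_pos hs0)
  refine ⟨4 / η + 24 / (η * s) + 2 * R / η, by positivity, fun N P m x hC hPN hm hmP hx => ?_⟩
  have c1 : 0 < 4 / η := by positivity
  have c2 : 0 < 24 / (η * s) := by positivity
  have c3 : 0 < 2 * R / η := by positivity
  have hP0 : (0 : ℝ) < P := by linarith
  have hN0 : 0 < N := by linarith
  have hm1 : (1 : ℝ) ≤ m := by exact_mod_cast hm
  have hmP' : (m : ℝ) ≤ P := by exact_mod_cast hmP
  have hP1 : (1 : ℝ) ≤ P := hm1.trans hmP'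
  have hmδ : 0 < (m : ℝ) - δ := by linarith
  have hxpos : 0 < norm2 x := lt_of_lt_of_le (by positivity) hx
  have hx0 : x ≠ 0 := by rintro rfl; rw [norm2_zero] at hxpos; exact lt_irrefl _ hxpos
  have hmono : bessel (norm2 x / N) ≤ bessel (((m : ℝ) - δ) / P) := by
    refine bessel_anti (by positivity) ?_
    rw [le_div_iff₀ hN0]
    calc _ = ((m : ℝ) - δ) * N / P := by ring
      _ ≤ _ := hx
  set a := ((m : ℝ) + 1) / (m - δ) with ha
  have ha1 : 1 ≤ a := by rw [ha, one_le_div hmδ]; linarith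
  have hdiff : bessel (((m : ℝ) - δ) / P) ≤ bessel (((m : ℝ) + 1) / P) + (a ^ 2 - 1) := by
    have := bessel_sub_le_sq (r := ((m : ℝ) - δ) / P) (by positivity) ha1
    have e : a * (((m : ℝ) - δ) / P) = ((m : ℝ) + 1) / P := by rw [ha]; field_simp
    rw [e] at this
    linarith
  rw [add_mul, one_mul]
  rcases le_or_gt (((m : ℝ) + 1) / P) η with hc | hc
  · have hbig := hη _ (by positivity) hc
    rw [div_le_iff₀ hε] at hbig
    have h2 := (abs_le.1 (hK N x hN0 hx0)).2
    have ha2 : a ≤ 2 / (1 - δ) := by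
      rw [ha, div_le_div_iff₀ hmδ h1δ]
      nlinarith
    have ha3 : a ^ 2 ≤ (2 / (1 - δ)) ^ 2 := by gcongr
    linarith
  -- Macroscopic distance: the three summands of the constant make m - δ at least ηP/2, the ratio
  -- `a` close to 1, and |x| at least `R`.
  · rw [lt_div_iff₀ hP0] at hc
    have k1 : 4 ≤ η * P := by
      have : 4 / η ≤ P := by linarith
      rw [div_le_iff₀ hη0] at this; linarith
    have k2 : 24 ≤ η * P * s := by
      have : 24 / (η * s) ≤ P := by linarith
      rw [div_le_iff₀ (by positivity)] at this; linarith
    have k3 : 2 * R ≤ η * P := by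
      have : 2 * R / η ≤ P := by linarith
      rw [div_le_iff₀ hη0] at this; linarith
    have hmd : η * P / 2 ≤ (m : ℝ) - δ := by linarith
    have hfar : R ≤ norm2 x := by
      refine le_trans ?_ hx
      rw [mul_div_assoc]
      have : 1 ≤ N / P := (one_le_div hP0).2 hPN
      exact le_trans (by linarith) (le_mul_of_one_le_right hmδ.le this)
    have h2 := (abs_le.1 (hR N x hN0 hfar)).2
    have ha4 : a - 1 ≤ 4 / (η * P) := by
      have : a - 1 = (1 + δ) / (m - δ) := by rw [ha]; field_simp; ring
      rw [this, div_le_div_iff₀ hmδ (by positivity)]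
      have : (1 + δ) * (η * P) ≤ 2 * (η * P) := by gcongr; linarith
      linarith
    have h5 : 4 / (η * P) ≤ 1 := (div_le_one (by positivity)).2 k1
    have h6 : 12 / (η * P) ≤ s / 2 := by
      rw [div_le_div_iff₀ (by positivity) (by norm_num)]; linarith
    have h7 : a ^ 2 - 1 ≤ s / 2 := by
      have e : 12 / (η * P) = 4 / (η * P) * 3 := by ring
      calc a ^ 2 - 1 = (a - 1) * (a + 1) := by ring
        _ ≤ 4 / (η * P) * 3 := mul_le_mul ha4 (by linarith) (by linarith) (by positivity)
        _ ≤ s / 2 := e ▸ h6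
    have h8 : bessel 2 ≤ bessel (((m : ℝ) + 1) / P) := by
      refine bessel_anti (by positivity) ?_
      rw [div_le_iff₀ hP0]; linarith
    have h9 : s ≤ ε * bessel (((m : ℝ) + 1) / P) := by rw [hs]; gcongr
    linarith

/-- Lower bound for the lattice Green function between nearby cells. -/
lemma exists_le_green {ε c : ℝ} (hε : 0 < ε) (hc : 1 ≤ c) : ∃ C : ℝ, 0 < C ∧
    ∀ (N : ℝ) (P m : ℕ) (x : ℤ × ℤ), C ≤ P → (P : ℝ) ≤ N → m ≤ P →
      norm2 x ≤ ((m : ℝ) + c) * N / P → (1 - ε) * bessel (((m : ℝ) + c) / P) ≤ green N x := by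
  obtain ⟨K, hK0, hK⟩ := exists_abs_green_sub_bessel_le
  obtain ⟨η, hη0, hη1, hη⟩ := exists_le_bessel (K / ε)
  have hb := bessel_pos (r := 2) (by norm_num)
  set s := ε * bessel 2 with hs
  have hs0 : 0 < s := by positivity
  obtain ⟨R, hR1, hR⟩ := exists_abs_green_sub_bessel_le_of_far hs0
  -- For lattice points closer than `R` although ρ > η: R/N ≤ η' then makes the Green function
  -- exceed `bessel η`, hence `bessel ρ`.
  obtain ⟨η', hη'0, hη'1, hη'⟩ := exists_le_bessel (bessel η + K)
  refine ⟨c + R / η', by positivity, fun N P m x hC hPN hmP hx => ?_⟩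
  have c1 : 0 < R / η' := by positivity
  have hP0 : (0 : ℝ) < P := by linarith
  have hN0 : 0 < N := by linarith
  have hmP' : (m : ℝ) ≤ P := by exact_mod_cast hmP
  have hm0 : (0 : ℝ) ≤ m := by positivity
  set ρ := ((m : ℝ) + c) / P with hρ
  have hρ0 : 0 < ρ := by positivity
  have hρN : norm2 x ≤ ρ * N := by rw [hρ]; convert hx using 1; ring
  have hρN1 : 1 ≤ ρ * N := by
    have : 1 ≤ N / P := (one_le_div hP0).2 hPN
    have e : ρ * N = (m + c) * (N / P) := by rw [hρ]; ring
    rw [e]; nlinarith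
  have hbase : ∀ L, 1 ≤ L → norm2 x ≤ L → bessel (L / N) - K ≤ green N x := by
    intro L hL1 hL
    by_cases hx0 : x = 0
    · have h1 := (abs_le.1 (hK N (1, 0) hN0 (by decide))).1
      have h2 : norm2 (1, 0) = 1 := by simp [norm2]
      rw [h2] at h1
      have h3 : bessel (L / N) ≤ bessel (1 / N) := bessel_anti (by positivity) (by gcongr)
      rw [hx0]
      linarith [green_unit_le N hN0]
    · have h1 := (abs_le.1 (hK N x hN0 hx0)).1
      have h2 := one_le_norm2 hx0
      have h3 : bessel (L / N) ≤ bessel (norm2 x / N) := bessel_anti (by positivity) (by gcongr)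
      linarith
  rw [sub_mul, one_mul]
  rcases le_or_gt ρ η with h | h
  · have hbig := hη ρ hρ0 h
    rw [div_le_iff₀ hε] at hbig
    have h1 := hbase (ρ * N) hρN1 hρN
    rw [mul_div_cancel_right₀ _ hN0.ne'] at h1
    linarith
  · have h8 : bessel 2 ≤ bessel ρ := by
      refine bessel_anti hρ0 ?_
      rw [hρ, div_le_iff₀ hP0]; linarith
    have h9 : s ≤ ε * bessel ρ := by rw [hs]; gcongr
    rcases le_or_gt R (norm2 x) with hr | hr
    · have h1 := (abs_le.1 (hR N x hN0 hr)).1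
      have h2 : bessel ρ ≤ bessel (norm2 x / N) := by
        refine bessel_anti (div_pos (by linarith) hN0) ?_
        rw [div_le_iff₀ hN0]; exact hρN
      linarith
    · have h1 := hbase R hR1 hr.le
      have h2 := hη' (R / N) (by positivity) (by
        have : R / η' ≤ N := by linarith
        rw [div_le_iff₀ hη'0] at this
        rw [div_le_iff₀ hN0]; linarith)
      have h3 : bessel ρ ≤ bessel η := bessel_anti hη0 h.le
      linarith

/-! ### Averages of the Brownian Green function over cells -/

/-- The `i`-th cell of the partition of `(0, 1]` into `M` intervals. -/
def cell (M i : ℕ) : Set ℝ := Ioc (((i : ℝ) - 1) / M) (i / M)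

lemma measurableSet_cell (M i : ℕ) : MeasurableSet (cell M i) := measurableSet_Ioc

lemma mul_volume_cell {M : ℕ} (hM : 0 < M) (i : ℕ) : (M : ℝ≥0∞) * volume (cell M i) = 1 := by
  have hM' : (0 : ℝ) < M := by exact_mod_cast hM
  rw [cell, Real.volume_Ioc, show (i : ℝ) / M - (i - 1) / M = (M : ℝ)⁻¹ by field_simp; ring,
    ENNReal.ofReal_inv_of_pos hM', ENNReal.ofReal_natCast]
  exact ENNReal.mul_inv_cancel (by exact_mod_cast hM.ne') (ENNReal.natCast_ne_top M)

lemma abs_sub_le_of_mem_cell {M i j : ℕ} (hM : 0 < M) {u v : ℝ} (hu : u ∈ cell M i)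
    (hv : v ∈ cell M j) : M * |u - v| ≤ |(i : ℝ) - j| + 1 := by
  have hM' : (0 : ℝ) < M := by exact_mod_cast hM
  obtain ⟨a1, a2⟩ := hu
  obtain ⟨b1, b2⟩ := hv
  rw [div_lt_iff₀ hM'] at a1 b1
  rw [le_div_iff₀ hM'] at a2 b2
  rw [show (M : ℝ) * |u - v| = |(M : ℝ) * (u - v)| by rw [abs_mul, abs_of_pos hM'], abs_le, mul_sub]
  constructor <;> linarith [le_abs_self ((i : ℝ) - j), neg_abs_le ((i : ℝ) - j)]

lemma le_abs_sub_of_mem_cell {M i j : ℕ} (hM : 0 < M) {u v : ℝ} (hu : u ∈ cell M i)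
    (hv : v ∈ cell M j) : |(i : ℝ) - j| - 1 ≤ M * |u - v| := by
  have hM' : (0 : ℝ) < M := by exact_mod_cast hM
  obtain ⟨a1, a2⟩ := hu
  obtain ⟨b1, b2⟩ := hv
  rw [div_lt_iff₀ hM'] at a1 b1
  rw [le_div_iff₀ hM'] at a2 b2
  rw [show (M : ℝ) * |u - v| = |(M : ℝ) * (u - v)| by rw [abs_mul, abs_of_pos hM'], mul_sub]
  have h1 := le_abs_self ((M : ℝ) * u - M * v)
  have h2 := neg_abs_le ((M : ℝ) * u - M * v)
  rcases abs_cases ((i : ℝ) - j) with ⟨h, _⟩ | ⟨h, _⟩ <;> rw [h] <;> linarith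

lemma intervalIntegrable_inv_sqrt_abs :
    IntervalIntegrable (fun s : ℝ => (√|s|)⁻¹) volume (-1) 1 := by
  have h01 : IntervalIntegrable (fun s : ℝ => (√|s|)⁻¹) volume 0 1 := by
    refine (intervalIntegral.intervalIntegrable_rpow' (r := -(1 / 2)) (by norm_num)).congr ?_
    intro s hs
    rw [uIoc_of_le zero_le_one] at hs
    simp only
    rw [abs_of_pos hs.1, Real.sqrt_eq_rpow, Real.rpow_neg hs.1.le]
  have h10 := (IntervalIntegrable.iff_comp_neg).1 h01
  simp only [abs_neg, neg_zero] at h10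
  exact h10.symm.trans h01

/-- With s = M(u - v), the integrand is at most 1 when |s| ≥ 1, and |s|^(-1/2) is integrable on (-1,
1]; the bound is thus uniform in `M`, `i` and `u`. -/
lemma exists_average_inv_sqrt_le : ∃ I : ℝ, 0 ≤ I ∧ ∀ (M i : ℕ) (u : ℝ), 0 < M →
    (M : ℝ≥0∞) * ∫⁻ v in cell M i, ENNReal.ofReal (√(M * |u - v|))⁻¹ ≤ ENNReal.ofReal I := by
  set φ : ℝ → ℝ≥0∞ := (Ioc (-1 : ℝ) 1).indicator fun s => ENNReal.ofReal (√|s|)⁻¹ with hφ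
  have hφm : Measurable φ := Measurable.indicator (by fun_prop) measurableSet_Ioc
  have hfin : ∫⁻ s, φ s ≠ ⊤ := by
    rw [hφ, lintegral_indicator measurableSet_Ioc]
    have := (intervalIntegrable_iff_integrableOn_Ioc_of_le (by norm_num)).1
      intervalIntegrable_inv_sqrt_abs
    have h2 := this.lintegral_lt_top
    exact h2.ne
  refine ⟨1 + (∫⁻ s, φ s).toReal, by positivity, fun M i u hM => ?_⟩
  have hM' : (0 : ℝ) < M := by exact_mod_cast hM
  have hM0 : (M : ℝ≥0∞) ≠ 0 := by exact_mod_cast hM.ne'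
  rw [ENNReal.ofReal_add zero_le_one (by positivity), ENNReal.ofReal_toReal hfin, ENNReal.ofReal_one]
  have hpt : ∀ v, ENNReal.ofReal (√(M * |u - v|))⁻¹ ≤ 1 + φ (M * (u - v)) := by
    intro v
    by_cases h : (M : ℝ) * (u - v) ∈ Ioc (-1 : ℝ) 1
    · rw [hφ, indicator_of_mem h, abs_mul, abs_of_pos hM']
      exact le_add_self
    · refine le_trans ?_ le_self_add
      rw [← ENNReal.ofReal_one]
      apply ENNReal.ofReal_le_ofReal
      apply inv_le_one_of_one_le₀
      rw [Real.one_le_sqrt, show (M : ℝ) * |u - v| = |(M : ℝ) * (u - v)| by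
        rw [abs_mul, abs_of_pos hM']]
      rw [mem_Ioc, not_and_or, not_lt, not_le] at h
      rcases h with h | h
      · linarith [neg_abs_le ((M : ℝ) * (u - v))]
      · linarith [le_abs_self ((M : ℝ) * (u - v))]
  have hscale : ∫⁻ v, φ (M * (u - v)) = (M : ℝ≥0∞)⁻¹ * ∫⁻ s, φ s := by
    rw [lintegral_sub_left_eq_self (fun v => φ (M * v)) u,
      ← lintegral_map (f := φ) (g := fun v : ℝ => (M : ℝ) * v) hφm (by fun_prop),
      Real.map_volume_mul_left hM'.ne', lintegral_smul_measure, abs_of_pos (by positivity),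
      ENNReal.ofReal_inv_of_pos hM', ENNReal.ofReal_natCast, smul_eq_mul]
  calc (M : ℝ≥0∞) * ∫⁻ v in cell M i, ENNReal.ofReal (√(M * |u - v|))⁻¹
      ≤ M * (∫⁻ v in cell M i, (1 + φ (M * (u - v)))) := by gcongr with v; exact hpt v
    _ = M * (volume (cell M i) + ∫⁻ v in cell M i, φ (M * (u - v))) := by
      rw [lintegral_add_left measurable_const]; simp
    _ ≤ M * (volume (cell M i) + ∫⁻ v, φ (M * (u - v))) := by
      gcongr; exact Measure.restrict_le_self
    _ = 1 + ∫⁻ s, φ s := by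
      rw [mul_add, mul_volume_cell hM, hscale, ← mul_assoc, ENNReal.mul_inv_cancel hM0
        (ENNReal.natCast_ne_top M), one_mul]

lemma ae_ne_real (u : ℝ) (s : Set ℝ) : ∀ᵐ v ∂(volume.restrict s), v ≠ u := by
  refine ae_restrict_of_ae ?_
  rw [ae_iff]
  simp

/-- The average of the Brownian Green function over a cell is controlled by its value
at the distance of the cells. -/
lemma exists_average_kernelE_le {ε c : ℝ} (hε : 0 < ε) (hc : 1 ≤ c) : ∃ M₀ : ℝ, 0 < M₀ ∧
    ∀ (M i j : ℕ) (u : ℝ), M₀ ≤ M → |(i : ℝ) - j| ≤ M → u ∈ cell M i →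
      (M : ℝ≥0∞) * ∫⁻ v in cell M j, kernelE |u - v| ≤
        ENNReal.ofReal ((1 + ε) * bessel ((|(i : ℝ) - j| + c) / M)) := by
  obtain ⟨I, hI0, hI⟩ := exists_average_inv_sqrt_le
  obtain ⟨D, hD0, hD⟩ := exists_bessel_sub_le_sqrt
  set A := D * √(2 + c) * (1 + I) with hA
  have hA0 : 0 < A := by positivity
  obtain ⟨η, hη0, hη1, hη⟩ := exists_le_bessel (A / ε)
  have hb := bessel_pos (r := 2) (by norm_num)
  set s := ε * bessel 2 with hs
  have hs0 : 0 < s := by positivity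
  refine ⟨c + 4 * (c + 1) / η + 6 * (c + 1) / (η * s), by positivity,
    fun M i j u hM hm hu => ?_⟩
  have c1 : 0 < 4 * (c + 1) / η := by positivity
  have c2 : 0 < 6 * (c + 1) / (η * s) := by positivity
  have hM' : (0 : ℝ) < M := by linarith
  have hM0 : 0 < M := by exact_mod_cast hM'
  set m := |(i : ℝ) - j| with hmdef
  have hm0 : 0 ≤ m := abs_nonneg _
  have hmint : m ≤ 1 ∨ 2 ≤ m := by
    have e : m = ((|(i : ℤ) - j| : ℤ) : ℝ) := by rw [hmdef]; push_cast; rfl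
    rcases le_or_gt (|(i : ℤ) - j|) 1 with h | h
    · left; rw [e]; exact_mod_cast h
    · right; rw [e]; exact_mod_cast h
  set ρ := (m + c) / M with hρ
  have hρ0 : 0 < ρ := by positivity
  rw [add_mul, one_mul, ENNReal.ofReal_add (bessel_nonneg _)
    (mul_nonneg hε.le (bessel_nonneg _))]
  rcases le_or_gt ρ η with h | h
  · have hbig := hη ρ hρ0 h
    rw [div_le_iff₀ hε] at hbig
    have hpt : ∀ v ∈ cell M j, v ≠ u → kernelE |u - v| ≤ ENNReal.ofReal (bessel ρ) +
        (ENNReal.ofReal (D * √(2 + c)) +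
          ENNReal.ofReal (D * √(2 + c)) * ENNReal.ofReal (√(M * |u - v|))⁻¹) := by
      intro v hv hne
      have hr : 0 < |u - v| := abs_pos.2 (sub_ne_zero.2 hne.symm)
      have hw := abs_sub_le_of_mem_cell hM0 hu hv
      have hw' := le_abs_sub_of_mem_cell hM0 hu hv
      set w := (M : ℝ) * |u - v| with hwdef
      have hw0 : 0 < w := by positivity
      have ha : 1 ≤ (m + c) / w := by rw [one_le_div hw0]; linarith
      have h1 := hD |u - v| ((m + c) / w) hr ha
      have e : (m + c) / w * |u - v| = ρ := by rw [hwdef, hρ]; field_simp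
      rw [e] at h1
      -- As m ≤ w + 1, the ratio is large only when `w` is small; its square root costs w^(-1/2),
      -- whose cell average is at most `I`.
      have h2 : (m + c) / w ≤ (2 + c) * (1 + w⁻¹) := by
        have e' : (2 + c) * (1 + w⁻¹) * w = (2 + c) * (w + 1) := by field_simp
        rw [div_le_iff₀ hw0, e']
        rcases hmint with hm1 | hm2
        · nlinarith
        · have : (2 + c) * m ≤ (2 + c) * (w + 1) := by gcongr; linarith
          nlinarith
      have h3 : √((m + c) / w) ≤ √(2 + c) * (1 + (√w)⁻¹) := by
        refine (Real.sqrt_le_sqrt h2).trans ?_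
        rw [Real.sqrt_mul (by positivity)]
        gcongr
        rw [Real.sqrt_le_left (by positivity), ← Real.sqrt_inv]
        have := Real.sq_sqrt (inv_nonneg.2 hw0.le)
        nlinarith [Real.sqrt_nonneg w⁻¹]
      rw [kernelE_eq hr, ← ENNReal.ofReal_mul (by positivity), ← ENNReal.ofReal_add
        (by positivity) (by positivity), ← ENNReal.ofReal_add (bessel_nonneg _) (by positivity)]
      apply ENNReal.ofReal_le_ofReal
      have h4 : D * √((m + c) / w) ≤ D * (√(2 + c) * (1 + (√w)⁻¹)) := by gcongr
      linarith
    have hInt : ∫⁻ v in cell M j, kernelE |u - v| ≤ ∫⁻ v in cell M j,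
        (ENNReal.ofReal (bessel ρ) + (ENNReal.ofReal (D * √(2 + c)) +
          ENNReal.ofReal (D * √(2 + c)) * ENNReal.ofReal (√(M * |u - v|))⁻¹)) := by
      refine lintegral_mono_ae ?_
      filter_upwards [ae_restrict_mem (measurableSet_cell M j), ae_ne_real u (cell M j)]
        with v hv hne using hpt v hv hne
    refine (mul_le_mul_right hInt _).trans ?_
    rw [lintegral_add_left measurable_const, lintegral_add_left measurable_const,
      lintegral_const_mul _ (by fun_prop)]
    simp only [lintegral_const, Measure.restrict_apply_univ]
    have hv := mul_volume_cell hM0 j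
    calc _ = ENNReal.ofReal (bessel ρ) * (M * volume (cell M j)) +
          (ENNReal.ofReal (D * √(2 + c)) * (M * volume (cell M j)) + ENNReal.ofReal (D * √(2 + c)) *
            (M * ∫⁻ v in cell M j, ENNReal.ofReal (√(M * |u - v|))⁻¹)) := by ring
      _ ≤ ENNReal.ofReal (bessel ρ) * 1 + (ENNReal.ofReal (D * √(2 + c)) * 1 +
          ENNReal.ofReal (D * √(2 + c)) * ENNReal.ofReal I) := by
        rw [hv]; gcongr; exact hI M j u hM0
      _ = ENNReal.ofReal (bessel ρ) + ENNReal.ofReal A := by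
        rw [mul_one, mul_one, ← ENNReal.ofReal_mul (by positivity), ← ENNReal.ofReal_add
          (by positivity) (by positivity), hA]
        ring_nf
      _ ≤ _ := by gcongr; linarith
  · rw [hρ, lt_div_iff₀ hM'] at h
    have k1 : 4 * (c + 1) ≤ η * M := by
      have : 4 * (c + 1) / η ≤ M := by linarith
      rw [div_le_iff₀ hη0] at this; linarith
    have k2 : 6 * (c + 1) ≤ η * M * s := by
      have : 6 * (c + 1) / (η * s) ≤ M := by linarith
      rw [div_le_iff₀ (by positivity)] at this; linarith
    have hm1 : η * M / 2 ≤ m - 1 := by linarith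
    have hηM : 0 < η * M := by positivity
    have hm1' : 0 < m - 1 := by linarith
    set a := (m + c) / (m - 1) with ha
    have ha1 : 1 ≤ a := by rw [ha, one_le_div hm1']; linarith
    have ha2 : a - 1 ≤ 2 * (c + 1) / (η * M) := by
      have : a - 1 = (c + 1) / (m - 1) := by rw [ha]; field_simp; ring
      rw [this, div_le_div_iff₀ hm1' hηM]
      have : (c + 1) * (η * M) ≤ (c + 1) * (2 * (m - 1)) :=
        mul_le_mul_of_nonneg_left (by linarith) (by linarith)
      linarith
    have ha3 : 2 * (c + 1) / (η * M) ≤ 1 := (div_le_one hηM).2 (by linarith)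
    have ha4 : a ^ 2 - 1 ≤ s := by
      calc a ^ 2 - 1 = (a - 1) * (a + 1) := by ring
        _ ≤ 2 * (c + 1) / (η * M) * 3 := mul_le_mul ha2 (by linarith) (by linarith) (by positivity)
        _ ≤ s := by
          rw [div_mul_eq_mul_div, div_le_iff₀ hηM]; linarith
    have h8 : bessel 2 ≤ bessel ρ := by
      refine bessel_anti hρ0 ?_
      rw [hρ, div_le_iff₀ hM']; linarith
    have h9 : s ≤ ε * bessel ρ := by rw [hs]; gcongr
    have hd : bessel ((m - 1) / M) ≤ bessel ρ + ε * bessel ρ := by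
      have := bessel_sub_le_sq (r := (m - 1) / M) (by positivity) ha1
      have e : a * ((m - 1) / M) = ρ := by rw [ha, hρ]; field_simp
      rw [e] at this
      linarith
    have hInt : ∫⁻ v in cell M j, kernelE |u - v| ≤
        ∫⁻ v in cell M j, ENNReal.ofReal (bessel ρ + ε * bessel ρ) := by
      refine lintegral_mono_ae ?_
      filter_upwards [ae_restrict_mem (measurableSet_cell M j)] with v hv
      have hw' := le_abs_sub_of_mem_cell hM0 hu hv
      have hle : (m - 1) / M ≤ |u - v| := by rw [div_le_iff₀ hM']; linarith
      refine (kernelE_anti (by positivity) hle).trans ?_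
      rw [kernelE_eq (by positivity)]
      exact ENNReal.ofReal_le_ofReal hd
    refine (mul_le_mul_right hInt _).trans ?_
    rw [lintegral_const, Measure.restrict_apply_univ, mul_left_comm, mul_volume_cell hM0, mul_one,
      ENNReal.ofReal_add (bessel_nonneg _) (mul_nonneg hε.le (bessel_nonneg _))]

/-! ### Energies of measures on the line -/

/-- The least energy of a probability measure on the unit segment. -/
def minEnergy : ℝ≥0∞ :=
  ⨅ (μ : Measure Plane) (_ : IsProbabilityMeasure μ) (_ : μ unitSegmentᶜ = 0), energy μ

lemma capBrownian_unitSegment : capBrownian unitSegment = minEnergy⁻¹ := rfl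

lemma minEnergy_le {μ : Measure Plane} [IsProbabilityMeasure μ] (h : μ unitSegmentᶜ = 0) :
    minEnergy ≤ energy μ :=
  iInf_le_of_le μ (iInf_le_of_le inferInstance (iInf_le_of_le h le_rfl))

lemma measurableSet_unitSegment : MeasurableSet unitSegment := by
  unfold unitSegment
  exact MeasurableSet.inter
    (measurableSet_Icc.preimage (by fun_prop : Measurable fun z : Plane => z 0))
    ((measurableSet_singleton (0 : ℝ)).preimage (by fun_prop : Measurable fun z : Plane => z 1))

/-- The energy of a measure on the line. -/
def lineEnergy (ρ : Measure ℝ) : ℝ≥0∞ := ∫⁻ u, ∫⁻ v, kernelE |u - v| ∂ρ ∂ρ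

/-- The embedding of the line as the first coordinate axis. -/
def axis (u : ℝ) : Plane := !₂[u, 0]

lemma measurable_axis : Measurable axis := by
  have : Continuous axis := by
    unfold axis
    fun_prop
  exact this.measurable

lemma dist_axis (u v : ℝ) : dist (axis u) (axis v) = |u - v| := by
  simp [axis, EuclideanSpace.dist_eq, Real.dist_eq, Real.sqrt_sq_eq_abs]

lemma energy_eq (μ : Measure Plane) : energy μ = ∫⁻ x, ∫⁻ y, kernelE (dist x y) ∂μ ∂μ := rfl

lemma energy_map_axis (ρ : Measure ℝ) [SFinite ρ] : energy (ρ.map axis) = lineEnergy ρ := by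
  have hm : Measurable fun p : Plane × Plane => kernelE (dist p.1 p.2) :=
    measurable_kernelE.comp (by fun_prop)
  have : SFinite (ρ.map axis) := inferInstance
  rw [energy_eq, lineEnergy, lintegral_map (Measurable.lintegral_prod_right' hm) measurable_axis]
  refine lintegral_congr fun u => ?_
  refine (lintegral_map (hm.comp (by fun_prop : Measurable fun y : Plane => (axis u, y)))
    measurable_axis).trans ?_
  simp [dist_axis]

lemma energy_smul {c : ℝ≥0∞} (hc : c ≠ ⊤) (μ : Measure Plane) :
    energy (c • μ) = c * c * energy μ := by
  rw [energy_eq, energy_eq]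
  simp only [lintegral_smul_measure, smul_eq_mul]
  rw [lintegral_const_mul' _ _ hc, mul_assoc]

/-- The homogeneous form of the variational definition: energy is quadratic in the measure, so
normalise and push forward to the axis. -/
lemma minEnergy_mul_sq_le (ρ : Measure ℝ) [IsFiniteMeasure ρ] (h : ρ (Icc 0 1)ᶜ = 0) :
    minEnergy * (ρ univ) ^ 2 ≤ lineEnergy ρ := by
  rcases eq_or_ne (ρ univ) 0 with h0 | h0
  · simp [h0]
  have ht : ρ univ ≠ ⊤ := measure_ne_top _ _
  set c := (ρ univ)⁻¹ with hc
  have hct : c ≠ ⊤ := ENNReal.inv_ne_top.2 h0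
  have hprob : IsProbabilityMeasure (c • ρ.map axis) := by
    constructor
    rw [Measure.smul_apply, Measure.map_apply measurable_axis MeasurableSet.univ, preimage_univ,
      smul_eq_mul, hc, ENNReal.inv_mul_cancel h0 ht]
  have hsupp : (c • ρ.map axis) unitSegmentᶜ = 0 := by
    have hm : ∀ᵐ z ∂ρ.map axis, z ∈ unitSegment := by
      refine (ae_map_iff measurable_axis.aemeasurable measurableSet_unitSegment).2 ?_
      have : ∀ᵐ u ∂ρ, u ∈ Icc (0 : ℝ) 1 := h
      filter_upwards [this] with u hu
      simpa [axis, unitSegment] using hu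
    rw [Measure.smul_apply, smul_eq_mul]
    have : (ρ.map axis) unitSegmentᶜ = 0 := hm
    rw [this, mul_zero]
  have key := minEnergy_le hsupp
  rw [energy_smul hct, energy_map_axis] at key
  calc minEnergy * (ρ univ) ^ 2 ≤ c * c * lineEnergy ρ * (ρ univ) ^ 2 := by gcongr
    _ = (c * ρ univ) * (c * ρ univ) * lineEnergy ρ := by ring
    _ = lineEnergy ρ := by rw [hc, ENNReal.inv_mul_cancel h0 ht]; simp

/-- A block lower bound for a double integral. -/
lemma sum_mul_le_lintegral_lintegral {X : Type*} [MeasurableSpace X] (μ : Measure X) (s : Finset ℕ)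
    {B : ℕ → Set X} (hB : ∀ i, MeasurableSet (B i)) (hd : (s : Set ℕ).PairwiseDisjoint B)
    (F : X → X → ℝ≥0∞) (b : ℕ → ℕ → ℝ≥0∞)
    (h : ∀ i ∈ s, ∀ j ∈ s, ∀ x ∈ B i, ∀ y ∈ B j, b i j ≤ F x y) :
    ∑ i ∈ s, ∑ j ∈ s, μ (B i) * μ (B j) * b i j ≤ ∫⁻ x, ∫⁻ y, F x y ∂μ ∂μ := by
  have hsub : ∀ f : X → ℝ≥0∞, ∑ i ∈ s, ∫⁻ x in B i, f x ∂μ ≤ ∫⁻ x, f x ∂μ := by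
    intro f
    rw [← lintegral_biUnion_finset hd fun i _ => hB i]
    exact setLIntegral_le_lintegral _ _
  refine le_trans (Finset.sum_le_sum fun i hi => ?_) (hsub _)
  have hin : ∀ x ∈ B i, ∑ j ∈ s, μ (B j) * b i j ≤ ∫⁻ y, F x y ∂μ := by
    intro x hx
    refine le_trans (Finset.sum_le_sum fun j hj => ?_) (hsub _)
    calc μ (B j) * b i j = ∫⁻ _ in B j, b i j ∂μ := by
          rw [lintegral_const, Measure.restrict_apply_univ, mul_comm]
      _ ≤ _ := setLIntegral_mono' (hB j) fun y hy => h i hi j hj x hx y hy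
  calc ∑ j ∈ s, μ (B i) * μ (B j) * b i j = ∫⁻ _ in B i, ∑ j ∈ s, μ (B j) * b i j ∂μ := by
        rw [lintegral_const, Measure.restrict_apply_univ, Finset.sum_mul]
        exact Finset.sum_congr rfl fun j _ => by ring
    _ ≤ _ := setLIntegral_mono' (hB i) hin

/-- The measure that spreads the mass `w i` uniformly over the `i`-th cell. -/
def smear (M : ℕ) (A : Finset ℕ) (w : ℕ → ℝ≥0∞) : Measure ℝ :=
  ∑ i ∈ A, (w i * M) • volume.restrict (cell M i)

lemma lintegral_smear (M : ℕ) (A : Finset ℕ) (w : ℕ → ℝ≥0∞) (f : ℝ → ℝ≥0∞) :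
    ∫⁻ u, f u ∂smear M A w = ∑ i ∈ A, w i * (M * ∫⁻ u in cell M i, f u) := by
  rw [smear, lintegral_finsetSum_measure]
  simp only [lintegral_smul_measure, smul_eq_mul, mul_assoc]

lemma smear_apply (M : ℕ) (A : Finset ℕ) (w : ℕ → ℝ≥0∞) {S : Set ℝ} (hS : MeasurableSet S) :
    smear M A w S = ∑ i ∈ A, w i * (M * volume (S ∩ cell M i)) := by
  simp [smear, Measure.restrict_apply hS, mul_assoc]

lemma smear_apply_of_subset {M : ℕ} (hM : 0 < M) (A : Finset ℕ) (w : ℕ → ℝ≥0∞) {S : Set ℝ}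
    (hS : MeasurableSet S) (h : ∀ i ∈ A, cell M i ⊆ S) : smear M A w S = ∑ i ∈ A, w i := by
  rw [smear_apply M A w hS]
  refine Finset.sum_congr rfl fun i hi => ?_
  rw [inter_eq_self_of_subset_right (h i hi), mul_volume_cell hM, mul_one]

lemma cell_subset {M i : ℕ} (hi : i ∈ Finset.Icc 1 M) : cell M i ⊆ Ioc 0 1 := by
  rw [Finset.mem_Icc] at hi
  have h1 : (1 : ℝ) ≤ i := by exact_mod_cast hi.1
  have h2 : (i : ℝ) ≤ M := by exact_mod_cast hi.2
  have h3 : (0 : ℝ) < M := by linarith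
  refine Ioc_subset_Ioc (div_nonneg (by linarith) h3.le) ((div_le_one h3).2 h2)

lemma pairwiseDisjoint_cell (M : ℕ) (s : Set ℕ) : s.PairwiseDisjoint (cell M) := by
  rcases Nat.eq_zero_or_pos M with rfl | hM
  · intro i _ j _ _
    simp [Function.onFun, cell]
  intro i _ j _ hij
  refine Set.disjoint_left.2 fun u hu hv => hij ?_
  have hM' : (0 : ℝ) < M := by exact_mod_cast hM
  obtain ⟨a1, a2⟩ := hu
  obtain ⟨b1, b2⟩ := hv
  rw [div_lt_iff₀ hM'] at a1 b1
  rw [le_div_iff₀ hM'] at a2 b2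
  have h1 : (i : ℝ) < j + 1 := by linarith
  have h2 : (j : ℝ) < i + 1 := by linarith
  have h1' : i < j + 1 := by exact_mod_cast h1
  have h2' : j < i + 1 := by exact_mod_cast h2
  omega

/-- The upper counterpart of `sum_mul_le_lintegral_lintegral`, for uniform mass on cells; one
averaged variable suffices. -/
lemma lineEnergy_smear_le {M : ℕ} (hM : 0 < M) (A : Finset ℕ) (w : ℕ → ℝ≥0∞)
    (b : ℕ → ℕ → ℝ≥0∞) (h : ∀ i ∈ A, ∀ j ∈ A, ∀ u ∈ cell M i,
      (M : ℝ≥0∞) * ∫⁻ v in cell M j, kernelE |u - v| ≤ b i j) :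
    lineEnergy (smear M A w) ≤ ∑ i ∈ A, ∑ j ∈ A, w i * w j * b i j := by
  rw [lineEnergy, lintegral_smear]
  refine Finset.sum_le_sum fun i hi => ?_
  have : ∫⁻ u in cell M i, ∫⁻ v, kernelE |u - v| ∂smear M A w ≤
      ∫⁻ _ in cell M i, ∑ j ∈ A, w j * b i j := by
    refine setLIntegral_mono' (measurableSet_cell M i) fun u hu => ?_
    rw [lintegral_smear]
    refine Finset.sum_le_sum fun j hj => ?_
    gcongr
    exact h i hi j hj u hu
  rw [lintegral_const, Measure.restrict_apply_univ] at this
  calc w i * (M * ∫⁻ u in cell M i, ∫⁻ v, kernelE |u - v| ∂smear M A w)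
      ≤ w i * (M * ((∑ j ∈ A, w j * b i j) * volume (cell M i))) := by gcongr
    _ = w i * ((M * volume (cell M i)) * ∑ j ∈ A, w j * b i j) := by ring
    _ = _ := by
      rw [mul_volume_cell hM, one_mul, Finset.mul_sum]
      exact Finset.sum_congr rfl fun j _ => by ring

/-! ### A nearly optimal profile with bounded density -/

/-- The part of the unit segment over the `k`-th cell; the origin belongs to the first one. -/
def segCell (M k : ℕ) : Set Plane := {z | z ∈ unitSegment ∧ max 1 ⌈(M : ℝ) * z 0⌉₊ = k}

lemma measurableSet_segCell (M k : ℕ) : MeasurableSet (segCell M k) := by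
  refine measurableSet_unitSegment.inter ?_
  have h : Measurable fun z : Plane => max 1 ⌈(M : ℝ) * z 0⌉₊ :=
    measurable_const.max (Nat.measurable_ceil.comp (by fun_prop))
  exact h (measurableSet_singleton k)

lemma segCell_bounds {M k : ℕ} {z : Plane} (hz : z ∈ segCell M k) :
    (k : ℝ) - 1 ≤ M * z 0 ∧ (M : ℝ) * z 0 ≤ k := by
  obtain ⟨⟨h01, -⟩, hk⟩ := hz
  have h0 : (0 : ℝ) ≤ M * z 0 := mul_nonneg (Nat.cast_nonneg _) h01.1
  constructor
  · rcases le_total ⌈(M : ℝ) * z 0⌉₊ 1 with h | h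
    · rw [max_eq_left h] at hk
      rw [← hk]; simpa using h0
    · rw [max_eq_right h] at hk
      rw [← hk]
      linarith [Nat.ceil_lt_add_one h0]
  · rw [← hk]
    exact (Nat.le_ceil _).trans (by exact_mod_cast le_max_right _ _)

lemma dist_eq_of_mem_unitSegment {x y : Plane} (hx : x ∈ unitSegment) (hy : y ∈ unitSegment) :
    dist x y = |x 0 - y 0| := by
  rw [EuclideanSpace.dist_eq, Fin.sum_univ_two, hx.2, hy.2]
  simp [Real.dist_eq, Real.sqrt_sq_eq_abs]

lemma mul_dist_le_of_mem_segCell {M k l : ℕ} {x y : Plane} (hx : x ∈ segCell M k)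
    (hy : y ∈ segCell M l) : M * dist x y ≤ |(k : ℝ) - l| + 1 := by
  have h1 := segCell_bounds hx
  have h2 := segCell_bounds hy
  rw [dist_eq_of_mem_unitSegment hx.1 hy.1,
    show (M : ℝ) * |x 0 - y 0| = |(M : ℝ) * (x 0 - y 0)| by
      rw [abs_mul, abs_of_nonneg (Nat.cast_nonneg M : (0 : ℝ) ≤ M)], abs_le, mul_sub]
  constructor <;> linarith [le_abs_self ((k : ℝ) - l), neg_abs_le ((k : ℝ) - l)]

lemma sum_measure_segCell {M : ℕ} (hM : 0 < M) (μ : Measure Plane) [IsProbabilityMeasure μ]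
    (h : μ unitSegmentᶜ = 0) : ∑ k ∈ Finset.Icc 1 M, μ (segCell M k) = 1 := by
  have hd : ((Finset.Icc 1 M : Finset ℕ) : Set ℕ).PairwiseDisjoint (segCell M) := by
    intro i _ j _ hij
    exact Set.disjoint_left.2 fun u hu hv => hij (hu.2.symm.trans hv.2)
  rw [← measure_biUnion_finset hd fun k _ => measurableSet_segCell M k]
  have : ⋃ k ∈ Finset.Icc 1 M, segCell M k = unitSegment := by
    ext z
    simp only [mem_iUnion, exists_prop, Finset.mem_Icc]
    constructor
    · rintro ⟨k, -, hz⟩; exact hz.1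
    · intro hz
      refine ⟨max 1 ⌈(M : ℝ) * z 0⌉₊, ⟨le_max_left _ _, max_le hM ?_⟩, hz, rfl⟩
      rw [Nat.ceil_le]
      exact mul_le_of_le_one_right (Nat.cast_nonneg _) hz.1.2
  rw [this]
  exact (prob_compl_eq_zero_iff measurableSet_unitSegment).1 h

/-- Points of the segment are at distance at most 1, so every energy is at least `kernelE 1`. -/
lemma minEnergy_pos : 0 < minEnergy := by
  have hb : 0 < kernelE 1 := by
    rw [kernelE_eq one_pos, ENNReal.ofReal_pos]; exact bessel_pos one_pos
  refine lt_of_lt_of_le hb ?_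
  refine le_iInf fun μ => le_iInf fun hμ => le_iInf fun h => ?_
  have hae : ∀ᵐ z ∂μ, z ∈ unitSegment := h
  rw [energy_eq]
  calc kernelE 1 = ∫⁻ _, ∫⁻ _, kernelE 1 ∂μ ∂μ := by simp
    _ ≤ _ := by
      refine lintegral_mono_ae ?_
      filter_upwards [hae] with x hx
      refine lintegral_mono_ae ?_
      filter_upwards [hae] with y hy
      refine kernelE_anti dist_nonneg ?_
      rw [dist_eq_of_mem_unitSegment hx hy, abs_le]
      constructor <;> linarith [hx.1.1, hx.1.2, hy.1.1, hy.1.2]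

/-- A nearly optimal measure may be singular, so its mass is respread uniformly over each of `M`
cells. Averaging the kernel over cells costs one factor 1 + ε, near-optimality the other, and the
density is at most `M`. -/
lemma exists_profile {ε : ℝ} (hε : 0 < ε) (hE : minEnergy ≠ ⊤) :
    ∃ (M : ℕ) (ρ : Measure ℝ), 0 < M ∧ (∀ S, MeasurableSet S → ρ S ≤ M * volume S) ∧
      ρ (Ioc 0 1) = 1 ∧ ρ univ = 1 ∧
      lineEnergy ρ ≤ ENNReal.ofReal ((1 + ε) ^ 2) * minEnergy := by
  obtain ⟨M₀, hM₀, hav⟩ := exists_average_kernelE_le hε (le_refl (1 : ℝ))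
  obtain ⟨μ, hμ, hsupp, hlt⟩ : ∃ μ : Measure Plane, IsProbabilityMeasure μ ∧
      μ unitSegmentᶜ = 0 ∧ energy μ < ENNReal.ofReal (1 + ε) * minEnergy := by
    have : minEnergy < ENNReal.ofReal (1 + ε) * minEnergy := by
      conv_lhs => rw [← one_mul minEnergy]
      refine ENNReal.mul_lt_mul_left minEnergy_pos.ne' hE ?_
      rw [← ENNReal.ofReal_one]
      exact (ENNReal.ofReal_lt_ofReal_iff (by linarith)).2 (by linarith)
    conv_lhs at this => rw [minEnergy]
    simp only [iInf_lt_iff] at this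
    obtain ⟨μ, h1, h2, h3⟩ := this
    exact ⟨μ, h1, h2, h3⟩
  obtain ⟨M, hM⟩ := exists_nat_ge M₀
  have hM' : (0 : ℝ) < M := hM₀.trans_le hM
  have hM0 : 0 < M := by exact_mod_cast hM'
  set w : ℕ → ℝ≥0∞ := fun k => μ (segCell M k) with hw
  have hsum : ∑ k ∈ Finset.Icc 1 M, w k = 1 := sum_measure_segCell hM0 μ hsupp
  refine ⟨M, smear M (Finset.Icc 1 M) w, hM0, fun S hS => ?_, ?_, ?_, ?_⟩
  · rw [smear_apply M _ w hS]
    calc _ ≤ ∑ i ∈ Finset.Icc 1 M, w i * (M * volume S) := by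
          gcongr; exact inter_subset_left
      _ = M * volume S := by rw [← Finset.sum_mul, hsum, one_mul]
  · rw [smear_apply_of_subset hM0 _ w measurableSet_Ioc fun i hi => cell_subset hi, hsum]
  · rw [smear_apply_of_subset hM0 _ w MeasurableSet.univ fun i _ => subset_univ _, hsum]
  · have hij : ∀ i ∈ Finset.Icc 1 M, ∀ j ∈ Finset.Icc 1 M, |(i : ℝ) - j| ≤ M := by
      intro i hi j hj
      rw [Finset.mem_Icc] at hi hj
      have a1 : (i : ℝ) ≤ M := by exact_mod_cast hi.2
      have a2 : (j : ℝ) ≤ M := by exact_mod_cast hj.2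
      have a3 : (0 : ℝ) ≤ i := Nat.cast_nonneg _
      have a4 : (0 : ℝ) ≤ j := Nat.cast_nonneg _
      rw [abs_le]; constructor <;> linarith
    have h1 := lineEnergy_smear_le hM0 (Finset.Icc 1 M) w
      (fun i j => ENNReal.ofReal ((1 + ε) * bessel ((|(i : ℝ) - j| + 1) / M)))
      fun i hi j hj u hu => hav M i j u hM (hij i hi j hj) hu
    have hd : ((Finset.Icc 1 M : Finset ℕ) : Set ℕ).PairwiseDisjoint (segCell M) := by
      intro i _ j _ hij
      exact Set.disjoint_left.2 fun u hu hv => hij (hu.2.symm.trans hv.2)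
    have h2 := sum_mul_le_lintegral_lintegral μ (Finset.Icc 1 M) (measurableSet_segCell M) hd
      (fun x y => kernelE (dist x y))
      (fun i j => ENNReal.ofReal (bessel ((|(i : ℝ) - j| + 1) / M)))
      fun i _ j _ x hx y hy => by
        have hpos : 0 < (|(i : ℝ) - j| + 1) / M := by positivity
        rw [← kernelE_eq hpos]
        refine kernelE_anti dist_nonneg ?_
        rw [le_div_iff₀ hM']
        linarith [mul_dist_le_of_mem_segCell hx hy]
    rw [← energy_eq] at h2
    have h1ε : 0 ≤ 1 + ε := by linarith
    calc lineEnergy (smear M (Finset.Icc 1 M) w) ≤ _ := h1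
      _ = ENNReal.ofReal (1 + ε) * ∑ i ∈ Finset.Icc 1 M, ∑ j ∈ Finset.Icc 1 M,
          w i * w j * ENNReal.ofReal (bessel ((|(i : ℝ) - j| + 1) / M)) := by
        simp only [Finset.mul_sum, ENNReal.ofReal_mul h1ε]
        exact Finset.sum_congr rfl fun i _ => Finset.sum_congr rfl fun j _ => by ring
      _ ≤ ENNReal.ofReal (1 + ε) * (ENNReal.ofReal (1 + ε) * minEnergy) := by
        gcongr; exact h2.trans hlt.le
      _ = _ := by rw [← mul_assoc, ← ENNReal.ofReal_mul h1ε, ← sq]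

/-! ### Capacity of a union of small sets -/

lemma finite_latticeBall (r : ℝ) : (latticeBall r).Finite := by
  refine (((Set.finite_Icc (-⌈r⌉) ⌈r⌉)).prod (Set.finite_Icc (-⌈r⌉) ⌈r⌉)).subset fun z hz => ?_
  have hz : eucl z 0 ≤ r := hz
  rw [eucl_eq, sub_zero, norm2] at hz
  have h1 : |(z.1 : ℝ)| ≤ r := (Real.abs_le_sqrt (by nlinarith [sq_nonneg (z.2 : ℝ)])).trans hz
  have h2 : |(z.2 : ℝ)| ≤ r := (Real.abs_le_sqrt (by nlinarith [sq_nonneg (z.1 : ℝ)])).trans hz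
  have h3 := Int.le_ceil r
  rw [abs_le] at h1 h2
  have a1 : -(⌈r⌉ : ℝ) ≤ z.1 := by linarith
  have a2 : (z.1 : ℝ) ≤ ⌈r⌉ := by linarith
  have a3 : -(⌈r⌉ : ℝ) ≤ z.2 := by linarith
  have a4 : (z.2 : ℝ) ≤ ⌈r⌉ := by linarith
  exact ⟨⟨by exact_mod_cast a1, by exact_mod_cast a2⟩, ⟨by exact_mod_cast a3, by exact_mod_cast a4⟩⟩

lemma equil_of_notMem (N : ℝ) {K : Set (ℤ × ℤ)} {x : ℤ × ℤ} (hx : x ∉ K) : equil N K x = 0 :=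
  if_neg hx

/-- A lower bound for the capacity of a union, by mixing the equilibrium measures of its parts. -/
lemma sq_sum_le_mul_cap {N κ : ℝ} (hN : 0 < N) (hκ : 0 < κ) (A : Finset ℕ)
    (T : ℕ → Finset (ℤ × ℤ)) (K : Finset (ℤ × ℤ)) (hT : ∀ i ∈ A, T i ⊆ K) (a : ℕ → ℝ)
    (ha : ∀ i, 0 ≤ a i) (b : ℕ → ℕ → ℝ) (hb0 : ∀ i j, 0 ≤ b i j)
    (hcap : ∀ i ∈ A, κ ≤ ∑ x ∈ T i, equil N (T i) x)
    (hb : ∀ i ∈ A, ∀ j ∈ A, i ≠ j → ∀ x ∈ T i, ∀ y ∈ T j, green N (x - y) ≤ b i j) :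
    (∑ i ∈ A, a i) ^ 2 ≤ ((∑ i ∈ A, a i ^ 2) / κ + ∑ i ∈ A, ∑ j ∈ A, a i * a j * b i j) *
      ∑ x ∈ K, equil N K x := by
  set cap : ℕ → ℝ := fun i => ∑ x ∈ T i, equil N (T i) x with hcapdef
  set n : ℕ → ℤ × ℤ → ℝ := fun i x => equil N (T i) x / cap i with hn
  have hcap0 : ∀ i ∈ A, 0 < cap i := fun i hi => hκ.trans_le (hcap i hi)
  have hn0 : ∀ i ∈ A, ∀ x, 0 ≤ n i x := fun i hi x =>
    div_nonneg (equil_nonneg _ _ _) (hcap0 i hi).le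
  have hnz : ∀ i x, x ∉ T i → n i x = 0 := fun i x hx => by
    simp only [hn]
    rw [equil_of_notMem N (by exact_mod_cast hx), zero_div]
  have hn1 : ∀ i ∈ A, ∑ x ∈ K, n i x = 1 := by
    intro i hi
    rw [← Finset.sum_subset (hT i hi) fun x _ hx => hnz i x hx]
    simp only [hn]
    rw [← Finset.sum_div]
    exact div_self (hcap0 i hi).ne'
  set q : ℕ → ℕ → ℝ := fun i j => ∑ x ∈ K, ∑ y ∈ K, n i x * n j y * green N (x - y) with hq
  -- A normalised equilibrium measure has energy 1/cap.
  have hqd : ∀ i ∈ A, q i i ≤ 1 / κ := by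
    intro i hi
    have e : q i i = 1 / cap i := by
      have h1 : q i i = ∑ x ∈ T i, ∑ y ∈ T i, n i x * n i y * green N (x - y) := by
        simp only [hq]
        rw [← Finset.sum_subset (hT i hi) fun x _ hx => by simp [hnz i x hx]]
        refine Finset.sum_congr rfl fun x _ => ?_
        rw [← Finset.sum_subset (hT i hi) fun y _ hy => by simp [hnz i y hy]]
      have h2 := energy_equil hN (T i)
      have hc := (hcap0 i hi).ne'
      have h3 : q i i = (∑ x ∈ T i, ∑ y ∈ T i,
          equil N (T i) x * equil N (T i) y * green N (x - y)) / cap i ^ 2 := by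
        rw [h1, Finset.sum_div]
        refine Finset.sum_congr rfl fun x _ => ?_
        rw [Finset.sum_div]
        refine Finset.sum_congr rfl fun y _ => ?_
        simp only [hn]
        field_simp
      rw [h3, h2]
      change cap i / cap i ^ 2 = _
      field_simp
    rw [e]
    exact one_div_le_one_div_of_le hκ (hcap i hi)
  have hqo : ∀ i ∈ A, ∀ j ∈ A, i ≠ j → q i j ≤ b i j := by
    intro i hi j hj hij
    calc q i j ≤ ∑ x ∈ K, ∑ y ∈ K, n i x * n j y * b i j := by
          refine Finset.sum_le_sum fun x _ => Finset.sum_le_sum fun y _ => ?_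
          by_cases hx : x ∈ T i
          · by_cases hy : y ∈ T j
            · exact mul_le_mul_of_nonneg_left (hb i hi j hj hij x hx y hy)
                (mul_nonneg (hn0 i hi x) (hn0 j hj y))
            · simp [hnz j y hy]
          · simp [hnz i x hx]
      _ = (∑ x ∈ K, n i x) * (∑ y ∈ K, n j y) * b i j := by
          rw [Finset.sum_mul_sum, Finset.sum_mul]
          exact Finset.sum_congr rfl fun x _ => by rw [Finset.sum_mul]
      _ = b i j := by rw [hn1 i hi, hn1 j hj]; ring
  have key := sq_sum_le_energy_mul_cap hN K fun x => ∑ i ∈ A, a i * n i x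
  have e1 : ∑ x ∈ K, ∑ i ∈ A, a i * n i x = ∑ i ∈ A, a i := by
    rw [Finset.sum_comm]
    refine Finset.sum_congr rfl fun i hi => ?_
    rw [← Finset.mul_sum, hn1 i hi, mul_one]
  have e2 : ∑ x ∈ K, ∑ y ∈ K, (∑ i ∈ A, a i * n i x) * (∑ i ∈ A, a i * n i y) * green N (x - y) =
      ∑ i ∈ A, ∑ j ∈ A, a i * a j * q i j := by
    simp only [hq, Finset.mul_sum]
    calc _ = ∑ x ∈ K, ∑ y ∈ K, ∑ i ∈ A, ∑ j ∈ A,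
            a i * n i x * (a j * n j y) * green N (x - y) := by
          refine Finset.sum_congr rfl fun x _ => Finset.sum_congr rfl fun y _ => ?_
          rw [← Finset.mul_sum, Finset.sum_mul_sum, Finset.sum_mul]
          exact Finset.sum_congr rfl fun i _ => by rw [Finset.sum_mul]
      _ = ∑ x ∈ K, ∑ i ∈ A, ∑ j ∈ A, ∑ y ∈ K, a i * n i x * (a j * n j y) * green N (x - y) := by
          refine Finset.sum_congr rfl fun x _ => ?_
          rw [Finset.sum_comm]
          exact Finset.sum_congr rfl fun i _ => Finset.sum_comm
      _ = ∑ i ∈ A, ∑ j ∈ A, ∑ x ∈ K, ∑ y ∈ K,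
            a i * n i x * (a j * n j y) * green N (x - y) := by
          rw [Finset.sum_comm]
          exact Finset.sum_congr rfl fun i _ => Finset.sum_comm
      _ = _ := Finset.sum_congr rfl fun i _ => Finset.sum_congr rfl fun j _ =>
          Finset.sum_congr rfl fun x _ => Finset.sum_congr rfl fun y _ => by ring
  rw [e1, e2] at key
  refine key.trans (mul_le_mul_of_nonneg_right ?_
    (Finset.sum_nonneg fun x _ => equil_nonneg _ _ _))
  rw [Finset.sum_div, ← Finset.sum_add_distrib]
  refine Finset.sum_le_sum fun i hi => ?_
  -- The diagonal terms of `b` are nonnegative; adding them completes the sum to all pairs, as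
  -- needed for comparison with a double integral.
  have hterm : ∀ j ∈ A, a i * a j * q i j ≤
      (if j = i then a i ^ 2 / κ else 0) + a i * a j * b i j := by
    intro j hj
    have hij : 0 ≤ a i * a j := mul_nonneg (ha i) (ha j)
    split_ifs with h
    · subst h
      have := mul_le_mul_of_nonneg_left (hqd j hj) hij
      have h2 := mul_nonneg hij (hb0 j j)
      calc a j * a j * q j j ≤ a j * a j * (1 / κ) := this
        _ = a j ^ 2 / κ := by ring
        _ ≤ _ := by linarith
    · rw [zero_add]
      exact mul_le_mul_of_nonneg_left (hqo i hi j hj (Ne.symm h)) hij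
  refine (Finset.sum_le_sum hterm).trans ?_
  rw [Finset.sum_add_distrib, Finset.sum_ite_eq' A i, if_pos hi]

/-- A lower bound for the capacity through the energy of the equilibrium measure, whose mass
is distributed among the parts. -/
lemma sum_fiber_le_cap {N : ℝ} (hN : 0 < N) (A : Finset ℕ) (K : Finset (ℤ × ℤ))
    (f : ℤ × ℤ → ℕ) (hf : ∀ x ∈ K, f x ∈ A) (b : ℕ → ℕ → ℝ)
    (hb : ∀ x ∈ K, ∀ y ∈ K, b (f x) (f y) ≤ green N (x - y)) :
    ∑ i ∈ A, ∑ j ∈ A, (∑ x ∈ K with f x = i, equil N K x) * (∑ x ∈ K with f x = j, equil N K x)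
      * b i j ≤ ∑ x ∈ K, equil N K x := by
  rw [← energy_equil hN K]
  have e : ∑ i ∈ A, ∑ j ∈ A, (∑ x ∈ K with f x = i, equil N K x) *
      (∑ x ∈ K with f x = j, equil N K x) * b i j =
      ∑ x ∈ K, ∑ y ∈ K, equil N K x * equil N K y * b (f x) (f y) := by
    rw [← Finset.sum_fiberwise_of_maps_to hf]
    refine Finset.sum_congr rfl fun i _ => ?_
    rw [Finset.sum_comm]
    conv_rhs => rw [← Finset.sum_fiberwise_of_maps_to hf]
    refine Finset.sum_congr rfl fun j _ => ?_
    rw [Finset.sum_mul_sum, Finset.sum_comm, Finset.sum_mul]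
    refine Finset.sum_congr rfl fun y hy => ?_
    rw [Finset.sum_mul]
    refine Finset.sum_congr rfl fun x hx => ?_
    rw [(Finset.mem_filter.1 hx).2, (Finset.mem_filter.1 hy).2]
  rw [e]
  exact Finset.sum_le_sum fun x hx => Finset.sum_le_sum fun y hy =>
    mul_le_mul_of_nonneg_left (hb x hx y hy) (mul_nonneg (equil_nonneg _ _ _) (equil_nonneg _ _ _))

lemma abs_natCast_sub (i j : ℕ) : |(i : ℝ) - j| = ((Int.natAbs ((i : ℤ) - j) : ℕ) : ℝ) := by
  rw [Nat.cast_natAbs]; push_cast; rfl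

lemma natAbs_sub_le {P i j : ℕ} (hi : i ∈ Finset.Icc 1 P) (hj : j ∈ Finset.Icc 1 P) :
    Int.natAbs ((i : ℤ) - j) ≤ P := by
  rw [Finset.mem_Icc] at hi hj; omega

/-- The upper bound on the capacity of a union of sets that are close to each other. -/
lemma exists_capN_iUnion_le {ε δ : ℝ} (hε : ε ∈ Ioo (0 : ℝ) 1) (hδ : δ ∈ Ioo (0 : ℝ) 1) :
    ∃ C : ℝ, 0 < C ∧ ∀ (N : ℝ) (P : ℕ) (A : Finset ℕ) (S : ℕ → Set (ℤ × ℤ)),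
      C ≤ (P : ℝ) → (P : ℝ) ≤ N → A ⊆ Finset.Icc 1 P →
      (∀ i ∈ A, S i ⊆ latticeBall (2 * N)) →
      (∀ i ∈ A, ∀ j ∈ A, ∀ x₁ ∈ S i, ∀ x₂ ∈ S j,
        eucl x₁ x₂ ≤ (|(i : ℝ) - (j : ℝ)| + 1 / δ) * N / P) →
      capN N (⋃ i ∈ A, S i) ≤ ENNReal.ofReal (1 + ε) * capBrownian unitSegment := by
  obtain ⟨hε0, hε1⟩ := hε
  obtain ⟨hδ0, hδ1⟩ := hδ
  have hc : 1 ≤ 1 / δ := (one_le_div hδ0).2 hδ1.le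
  set c := 1 / δ with hcdef
  set t := ε / 4 with ht
  have ht0 : 0 < t := by positivity
  have ht1 : 0 < 1 - t := by linarith
  obtain ⟨C₁, hC₁, hg⟩ := exists_le_green ht0 hc
  obtain ⟨M₀, hM₀, hav⟩ := exists_average_kernelE_le ht0 hc
  refine ⟨C₁ + M₀, by positivity, fun N P A S hCP hPN hA hS hclose => ?_⟩
  have hP' : (0 : ℝ) < P := by linarith
  have hP0 : 0 < P := by exact_mod_cast hP'
  have hN : 0 < N := by linarith
  have hfin : (⋃ i ∈ A, S i).Finite :=
    (finite_latticeBall (2 * N)).subset (iUnion₂_subset hS)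
  obtain ⟨K, hK⟩ := hfin.exists_finset_coe
  have hex : ∀ x, ∃ i, x ∈ K → i ∈ A ∧ x ∈ S i := by
    intro x
    by_cases hx : x ∈ K
    · have : x ∈ ⋃ i ∈ A, S i := by rw [← hK]; exact_mod_cast hx
      simp only [mem_iUnion, exists_prop] at this
      obtain ⟨i, hi⟩ := this
      exact ⟨i, fun _ => hi⟩
    · exact ⟨0, fun h => absurd h hx⟩
  -- The parts may overlap, so each point is assigned to a single part containing it.
  choose f hf using hex
  set B : ℕ → ℕ → ℝ := fun i j => bessel ((|(i : ℝ) - j| + c) / P) with hB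
  have hB0 : ∀ i j, 0 ≤ B i j := fun i j => bessel_nonneg _
  set W : ℕ → ℝ := fun i => ∑ x ∈ K with f x = i, equil N K x with hW
  have hW0 : ∀ i, 0 ≤ W i := fun i => Finset.sum_nonneg fun x _ => equil_nonneg _ _ _
  set cap := ∑ x ∈ K, equil N K x with hcap
  have hcap0 : 0 ≤ cap := Finset.sum_nonneg fun x _ => equil_nonneg _ _ _
  have h1 : ∑ i ∈ A, ∑ j ∈ A, W i * W j * ((1 - t) * B i j) ≤ cap :=
    sum_fiber_le_cap hN A K f (fun x hx => (hf x hx).1) (fun i j => (1 - t) * B i j)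
      fun x hx y hy => by
        have hi := (hf x hx).1
        have hj := (hf y hy).1
        have hd := hclose _ hi _ hj x (hf x hx).2 y (hf y hy).2
        rw [eucl_eq, abs_natCast_sub] at hd
        have := hg N P _ (x - y) (by linarith) hPN (natAbs_sub_le (hA hi) (hA hj)) hd
        rw [← abs_natCast_sub] at this
        exact this
  set ρ := smear P A fun i => ENNReal.ofReal (W i) with hρ
  have h2 : lineEnergy ρ ≤ ∑ i ∈ A, ∑ j ∈ A,
      ENNReal.ofReal (W i) * ENNReal.ofReal (W j) * ENNReal.ofReal ((1 + t) * B i j) :=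
    lineEnergy_smear_le hP0 A _ _ fun i hi j hj u hu => by
      refine hav P i j u (by linarith) ?_ hu
      rw [abs_natCast_sub]
      exact_mod_cast natAbs_sub_le (hA hi) (hA hj)
  have h3 : lineEnergy ρ ≤ ENNReal.ofReal ((1 + ε) * cap) := by
    refine h2.trans ?_
    have e : ∑ i ∈ A, ∑ j ∈ A,
        ENNReal.ofReal (W i) * ENNReal.ofReal (W j) * ENNReal.ofReal ((1 + t) * B i j) =
        ENNReal.ofReal (∑ i ∈ A, ∑ j ∈ A, W i * W j * ((1 + t) * B i j)) := by
      have hnn : ∀ i j, 0 ≤ W i * W j * ((1 + t) * B i j) := fun i j =>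
        mul_nonneg (mul_nonneg (hW0 i) (hW0 j)) (mul_nonneg (by linarith) (hB0 i j))
      rw [ENNReal.ofReal_sum_of_nonneg fun i _ => Finset.sum_nonneg fun j _ => hnn i j]
      refine Finset.sum_congr rfl fun i _ => ?_
      rw [ENNReal.ofReal_sum_of_nonneg fun j _ => hnn i j]
      refine Finset.sum_congr rfl fun j _ => ?_
      rw [ENNReal.ofReal_mul (mul_nonneg (hW0 i) (hW0 j)), ENNReal.ofReal_mul (hW0 i)]
    rw [e]
    apply ENNReal.ofReal_le_ofReal
    set Q := ∑ i ∈ A, ∑ j ∈ A, W i * W j * B i j with hQ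
    have e1 : ∑ i ∈ A, ∑ j ∈ A, W i * W j * ((1 + t) * B i j) = (1 + t) * Q := by
      simp only [hQ, Finset.mul_sum]
      exact Finset.sum_congr rfl fun i _ => Finset.sum_congr rfl fun j _ => by ring
    have e2 : ∑ i ∈ A, ∑ j ∈ A, W i * W j * ((1 - t) * B i j) = (1 - t) * Q := by
      simp only [hQ, Finset.mul_sum]
      exact Finset.sum_congr rfl fun i _ => Finset.sum_congr rfl fun j _ => by ring
    rw [e2] at h1
    rw [e1]
    have hQ0 : 0 ≤ Q := Finset.sum_nonneg fun i _ => Finset.sum_nonneg fun j _ =>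
      mul_nonneg (mul_nonneg (hW0 i) (hW0 j)) (hB0 i j)
    -- The choice t = ε/4 absorbs both the lattice error and the smearing error.
    have hle : 1 + t ≤ (1 + ε) * (1 - t) := by rw [ht]; nlinarith
    calc (1 + t) * Q ≤ (1 + ε) * (1 - t) * Q := by gcongr
      _ = (1 + ε) * ((1 - t) * Q) := by ring
      _ ≤ (1 + ε) * cap := by gcongr
  have hmass : ρ univ = ENNReal.ofReal cap := by
    rw [hρ, smear_apply_of_subset hP0 A _ MeasurableSet.univ fun i _ => subset_univ _,
      ← ENNReal.ofReal_sum_of_nonneg fun i _ => hW0 i]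
    congr 1
    exact Finset.sum_fiberwise_of_maps_to (fun x hx => (hf x hx).1) _
  have : IsFiniteMeasure ρ := ⟨by rw [hmass]; exact ENNReal.ofReal_lt_top⟩
  have hsupp : ρ (Icc 0 1)ᶜ = 0 := by
    rw [hρ, smear_apply P A _ measurableSet_Icc.compl]
    refine Finset.sum_eq_zero fun i hi => ?_
    have : (Icc (0 : ℝ) 1)ᶜ ∩ cell P i = ∅ := by
      rw [← Set.disjoint_iff_inter_eq_empty]
      exact disjoint_compl_left.mono_right ((cell_subset (hA hi)).trans Ioc_subset_Icc_self)
    simp [this]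
  have h4 := (minEnergy_mul_sq_le ρ hsupp).trans h3
  rw [hmass] at h4
  rw [← hK, capN_eq_sum, capBrownian_unitSegment, ← hcap, ← div_eq_mul_inv]
  rcases hcap0.eq_or_lt with h0 | h0
  · rw [← h0]; simp
  have hcne : ENNReal.ofReal cap ≠ 0 := by simpa using h0
  rw [ENNReal.le_div_iff_mul_le (Or.inl minEnergy_pos.ne') (Or.inr ENNReal.ofReal_ne_top)]
  rw [ENNReal.ofReal_mul (by linarith), sq, ← mul_assoc] at h4
  rw [mul_comm]
  exact (ENNReal.mul_le_mul_iff_left hcne ENNReal.ofReal_ne_top).1 h4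

/-- The lower bound on the capacity of a union of sets that are far from each other. -/
lemma exists_le_capN_iUnion {ε δ : ℝ} (hε : ε ∈ Ioo (0 : ℝ) 1) (hδ : δ ∈ Ioo (0 : ℝ) 1) :
    ∃ c₁ ∈ Ioo (0 : ℝ) 1, ∃ c₂ : ℝ, 0 < c₂ ∧ ∃ C : ℝ, 0 < C ∧
      ∀ (N : ℝ) (P : ℕ) (A : Finset ℕ) (S : ℕ → Set (ℤ × ℤ)) (κ : ℝ),
        C ≤ (P : ℝ) → (P : ℝ) ≤ N → A ⊆ Finset.Icc 1 P → c₁ * (P : ℝ) ≤ (A.card : ℝ) →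
        (∀ i ∈ A, S i ⊆ latticeBall (2 * N)) → 0 < κ →
        (∀ i ∈ A, ∀ j ∈ A, i ≠ j →
          ENNReal.ofReal ((|(i : ℝ) - (j : ℝ)| - δ) * N / P) ≤ setDist (S i) (S j)) →
        (∀ i ∈ A, ENNReal.ofReal κ ≤ capN N (S i)) →
        ((ENNReal.ofReal (c₂ * κ * P))⁻¹
            + ENNReal.ofReal (1 + ε) * (capBrownian unitSegment)⁻¹)⁻¹
          ≤ capN N (⋃ i ∈ A, S i) := by
  obtain ⟨hε0, hε1⟩ := hε
  rw [capBrownian_unitSegment, inv_inv]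
  -- If the minimal energy were infinite, the left side would be 0.
  rcases eq_or_ne minEnergy ⊤ with hE | hE
  · refine ⟨1 / 2, by norm_num, 1, one_pos, 1, one_pos, fun N P A S κ _ _ _ _ _ _ _ _ => ?_⟩
    rw [hE, ENNReal.mul_top (by simpa using by linarith)]
    simp
  set t := ε / 16 with ht
  have ht0 : 0 < t := by positivity
  have ht1 : t < 1 / 16 := by rw [ht]; linarith
  obtain ⟨M, ρ, hM, hdens, hmass, huniv, hen⟩ := exists_profile ht0 hE
  obtain ⟨C, hC, hg⟩ := exists_green_le ht0 hδ
  have hM' : (1 : ℝ) ≤ M := by exact_mod_cast hM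
  have hM0 : (0 : ℝ) < M := by linarith
  have h1t : 0 < 1 - t := by linarith
  -- At most tP/M indices are missing from `A`, each of mass at most M/P, so at most `t` of the mass
  -- is lost. The value of c₂ turns the self-energy M/(Pκ) into (c₂κP)⁻¹ after division by (1 - t)².
  refine ⟨1 - t / M, ⟨?_, ?_⟩, (1 - t) ^ 2 / M, by positivity, C, hC, ?_⟩
  · have : t / M ≤ t := div_le_self ht0.le hM'
    linarith
  · have : 0 < t / M := by positivity
    linarith
  intro N P A S κ hCP hPN hA hcard hS hκ hfar hcapS
  have hP' : (0 : ℝ) < P := by linarith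
  have hP0 : 0 < P := by exact_mod_cast hP'
  have hN : 0 < N := by linarith
  have hfin : ∀ i ∈ A, (S i).Finite := fun i hi => (finite_latticeBall (2 * N)).subset (hS i hi)
  have hex : ∀ i, ∃ T : Finset (ℤ × ℤ), i ∈ A → (T : Set (ℤ × ℤ)) = S i := by
    intro i
    by_cases hi : i ∈ A
    · obtain ⟨T, hT⟩ := (hfin i hi).exists_finset_coe
      exact ⟨T, fun _ => hT⟩
    · exact ⟨∅, fun h => absurd h hi⟩
  choose T hT using hex
  obtain ⟨K, hK⟩ := ((finite_latticeBall (2 * N)).subset (iUnion₂_subset hS)).exists_finset_coe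
  have hTK : ∀ i ∈ A, T i ⊆ K := by
    intro i hi x hx
    have : x ∈ (K : Set (ℤ × ℤ)) := by
      rw [hK]
      exact mem_biUnion (by exact_mod_cast hi) (by rw [← hT i hi]; exact_mod_cast hx)
    exact_mod_cast this
  have hfinρ : ∀ s, ρ s ≠ ⊤ := fun s =>
    ne_top_of_le_ne_top (by rw [huniv]; exact ENNReal.one_ne_top) (measure_mono (subset_univ s))
  set a : ℕ → ℝ := fun i => (ρ (cell P i)).toReal with ha
  have ha0 : ∀ i, 0 ≤ a i := fun i => ENNReal.toReal_nonneg
  have haM : ∀ i, a i ≤ M / P := by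
    intro i
    have h := hdens _ (measurableSet_cell P i)
    have hv : volume (cell P i) = (P : ℝ≥0∞)⁻¹ := by
      have := mul_volume_cell hP0 i
      rw [mul_comm] at this
      exact ENNReal.eq_inv_of_mul_eq_one_left this
    rw [hv] at h
    have h2 := ENNReal.toReal_mono (ENNReal.mul_ne_top (ENNReal.natCast_ne_top M)
      (ENNReal.inv_ne_top.2 (by exact_mod_cast hP0.ne'))) h
    simpa [div_eq_mul_inv] using h2
  have hsum_le : ∑ i ∈ A, a i ≤ 1 := by
    have h := measure_biUnion_finset (μ := ρ) (s := A) (pairwiseDisjoint_cell P A)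
      fun i _ => measurableSet_cell P i
    have h2 : ∑ i ∈ A, ρ (cell P i) ≤ 1 := by
      rw [← h, ← huniv]; exact measure_mono (subset_univ _)
    have h3 := ENNReal.toReal_mono ENNReal.one_ne_top h2
    rw [ENNReal.toReal_sum fun i _ => hfinρ _] at h3
    simpa using h3
  have hsum_ge : 1 ≤ ∑ i ∈ Finset.Icc 1 P, a i := by
    have hcov : Ioc (0 : ℝ) 1 ⊆ ⋃ i ∈ Finset.Icc 1 P, cell P i := by
      intro u hu
      have hPu : 0 < (P : ℝ) * u := mul_pos hP' hu.1
      simp only [mem_iUnion, exists_prop]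
      refine ⟨⌈(P : ℝ) * u⌉₊, ?_, ?_, ?_⟩
      · rw [Finset.mem_Icc]
        refine ⟨Nat.ceil_pos.2 hPu, Nat.ceil_le.2 (mul_le_of_le_one_right hP'.le hu.2)⟩
      · rw [div_lt_iff₀ hP']
        linarith [Nat.ceil_lt_add_one hPu.le]
      · rw [le_div_iff₀ hP']
        linarith [Nat.le_ceil ((P : ℝ) * u)]
    have h2 : 1 ≤ ∑ i ∈ Finset.Icc 1 P, ρ (cell P i) := by
      rw [← hmass]
      exact (measure_mono hcov).trans (measure_biUnion_finset_le _ _)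
    have h3 := ENNReal.toReal_mono (ENNReal.sum_ne_top.2 fun i _ => hfinρ _) h2
    rw [ENNReal.toReal_sum fun i _ => hfinρ _] at h3
    simpa using h3
  have hZ : 1 - t ≤ ∑ i ∈ A, a i := by
    have h1 := Finset.sum_sdiff (f := a) hA
    have h2 : ∑ i ∈ Finset.Icc 1 P \ A, a i ≤ t := by
      refine (Finset.sum_le_card_nsmul _ _ _ fun i _ => haM i).trans ?_
      rw [Finset.card_sdiff_of_subset hA, Nat.card_Icc, Nat.add_sub_cancel, nsmul_eq_mul,
        Nat.cast_sub (by simpa using Finset.card_le_card hA)]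
      rw [sub_mul, one_mul] at hcard
      calc ((P : ℝ) - A.card) * (M / P) ≤ (t / M * P) * (M / P) := by gcongr; linarith
        _ = t := by field_simp
    linarith
  set b : ℕ → ℕ → ℝ := fun i j => bessel ((|(i : ℝ) - j| + 1) / P) with hb
  have hb0 : ∀ i j, 0 ≤ b i j := fun i j => bessel_nonneg _
  have hcapT : ∀ i ∈ A, κ ≤ ∑ x ∈ T i, equil N (T i) x := by
    intro i hi
    have h := hcapS i hi
    rw [← hT i hi, capN_eq_sum] at h
    rwa [ENNReal.ofReal_le_ofReal_iff (Finset.sum_nonneg fun x _ => equil_nonneg _ _ _)] at h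
  have hgreen : ∀ i ∈ A, ∀ j ∈ A, i ≠ j → ∀ x ∈ T i, ∀ y ∈ T j,
      green N (x - y) ≤ (1 + t) * b i j := by
    intro i hi j hj hij x hx y hy
    have hd : ENNReal.ofReal ((|(i : ℝ) - (j : ℝ)| - δ) * N / P) ≤ ENNReal.ofReal (eucl x y) :=
      (hfar i hi j hj hij).trans (iInf₂_le_of_le x (by rw [← hT i hi]; exact_mod_cast hx)
        (iInf₂_le y (by rw [← hT j hj]; exact_mod_cast hy)))
    have he : 0 ≤ eucl x y := dist_nonneg
    rw [ENNReal.ofReal_le_ofReal_iff he, eucl_eq, abs_natCast_sub] at hd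
    have := hg N P _ (x - y) hCP hPN (by omega) (natAbs_sub_le (hA hi) (hA hj)) hd
    rw [← abs_natCast_sub] at this
    exact this
  have key := sq_sum_le_mul_cap hN hκ A T K hTK a ha0 (fun i j => (1 + t) * b i j)
    (fun i j => mul_nonneg (by linarith) (hb0 i j)) hcapT hgreen
  set cap := ∑ x ∈ K, equil N K x with hcap
  have hcap0 : 0 ≤ cap := Finset.sum_nonneg fun x _ => equil_nonneg _ _ _
  set e := minEnergy.toReal with hedef
  have he0 : 0 < e := ENNReal.toReal_pos minEnergy_pos.ne' hE
  have hsq : ∑ i ∈ A, a i ^ 2 ≤ M / P := by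
    calc ∑ i ∈ A, a i ^ 2 ≤ ∑ i ∈ A, M / P * a i := by
          refine Finset.sum_le_sum fun i _ => ?_
          rw [sq]
          exact mul_le_mul_of_nonneg_right (haM i) (ha0 i)
      _ = M / P * ∑ i ∈ A, a i := by rw [Finset.mul_sum]
      _ ≤ M / P * 1 := by gcongr
      _ = _ := mul_one _
  have hen2 : ∑ i ∈ A, ∑ j ∈ A, a i * a j * b i j ≤ (1 + t) ^ 2 * e := by
    have h1 := sum_mul_le_lintegral_lintegral ρ A (measurableSet_cell P) (pairwiseDisjoint_cell P A)
      (fun u v => kernelE |u - v|) (fun i j => ENNReal.ofReal (b i j))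
      fun i _ j _ u hu v hv => by
        have hpos : 0 < (|(i : ℝ) - j| + 1) / P := by positivity
        rw [hb, ← kernelE_eq hpos]
        refine kernelE_anti (abs_nonneg _) ?_
        rw [le_div_iff₀ hP']
        linarith [abs_sub_le_of_mem_cell hP0 hu hv]
    have h2 := h1.trans hen
    have h3 := ENNReal.toReal_mono (ENNReal.mul_ne_top ENNReal.ofReal_ne_top hE) h2
    rw [ENNReal.toReal_mul, ENNReal.toReal_ofReal (by positivity)] at h3
    refine le_trans (le_of_eq ?_) h3
    rw [ENNReal.toReal_sum fun i _ => ENNReal.sum_ne_top.2 fun j _ =>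
      ENNReal.mul_ne_top (ENNReal.mul_ne_top (hfinρ _) (hfinρ _)) ENNReal.ofReal_ne_top]
    refine Finset.sum_congr rfl fun i _ => ?_
    rw [ENNReal.toReal_sum fun j _ =>
      ENNReal.mul_ne_top (ENNReal.mul_ne_top (hfinρ _) (hfinρ _)) ENNReal.ofReal_ne_top]
    refine Finset.sum_congr rfl fun j _ => ?_
    rw [ENNReal.toReal_mul, ENNReal.toReal_mul, ENNReal.toReal_ofReal (hb0 i j)]
  have hen3 : ∑ i ∈ A, ∑ j ∈ A, a i * a j * ((1 + t) * b i j) ≤ (1 + t) ^ 3 * e := by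
    have e1 : ∑ i ∈ A, ∑ j ∈ A, a i * a j * ((1 + t) * b i j) =
        (1 + t) * ∑ i ∈ A, ∑ j ∈ A, a i * a j * b i j := by
      simp only [Finset.mul_sum]
      exact Finset.sum_congr rfl fun i _ => Finset.sum_congr rfl fun j _ => by ring
    rw [e1, show (1 + t) ^ 3 * e = (1 + t) * ((1 + t) ^ 2 * e) by ring]
    gcongr
  have hfinal : (1 - t) ^ 2 ≤ (M / P / κ + (1 + t) ^ 3 * e) * cap := by
    calc (1 - t) ^ 2 ≤ (∑ i ∈ A, a i) ^ 2 := by gcongr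
      _ ≤ _ := key
      _ ≤ _ := by gcongr
  set D := ((1 - t) ^ 2 / M * κ * P)⁻¹ + (1 + ε) * e with hD
  have hD0 : 0 < D := by positivity
  have hDcap : 1 ≤ D * cap := by
    -- Two factors 1 + t come from the profile, one from the Green function, and (1 - t)² from the
    -- lost mass.
    have h5 : (1 + t) ^ 3 ≤ (1 + ε) * (1 - t) ^ 2 := by
      have : ε = 16 * t := by rw [ht]; ring
      rw [this]
      nlinarith [mul_pos ht0 ht0, mul_pos (mul_pos ht0 ht0) ht0]
    have h6 : M / P / κ + (1 + t) ^ 3 * e ≤ (1 - t) ^ 2 * D := by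
      have e1 : (1 - t) ^ 2 * ((1 - t) ^ 2 / M * κ * P)⁻¹ = M / P / κ := by field_simp
      rw [hD, mul_add, e1]
      have := mul_le_mul_of_nonneg_right h5 he0.le
      linarith
    have h7 : (1 - t) ^ 2 * 1 ≤ (1 - t) ^ 2 * (D * cap) := by
      calc (1 - t) ^ 2 * 1 ≤ (M / P / κ + (1 + t) ^ 3 * e) * cap := by rw [mul_one]; exact hfinal
        _ ≤ (1 - t) ^ 2 * D * cap := by gcongr
        _ = _ := by ring
    exact le_of_mul_le_mul_left h7 (by positivity)
  have hlhs : (ENNReal.ofReal ((1 - t) ^ 2 / M * κ * P))⁻¹ + ENNReal.ofReal (1 + ε) * minEnergy =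
      ENNReal.ofReal D := by
    have hx : 0 < (1 - t) ^ 2 / M * κ * P := by positivity
    rw [hD, ENNReal.ofReal_add (inv_nonneg.2 hx.le) (by positivity),
      ENNReal.ofReal_inv_of_pos hx, ENNReal.ofReal_mul (p := 1 + ε) (by linarith), hedef,
      ENNReal.ofReal_toReal hE]
  rw [hlhs, ← hK, capN_eq_sum, ← ENNReal.ofReal_inv_of_pos hD0]
  apply ENNReal.ofReal_le_ofReal
  rw [inv_eq_one_div, div_le_iff₀ hD0]
  linarith

end

end PorousTube

theorem mainTheorem5 (ε δ : ℝ) (hε : ε ∈ Set.Ioo (0 : ℝ) 1) (hδ : δ ∈ Set.Ioo (0 : ℝ) 1) :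
    ∃ c₁ ∈ Set.Ioo (0 : ℝ) 1, ∃ c₂ : ℝ, 0 < c₂ ∧ ∃ C : ℝ, 0 < C ∧
      ∀ (N : ℝ) (P : ℕ) (A : Finset ℕ) (S : ℕ → Set (ℤ × ℤ)),
        C ≤ N → C ≤ (P : ℝ) → (P : ℝ) ≤ N →
        A ⊆ Finset.Icc 1 P → c₁ * (P : ℝ) ≤ (A.card : ℝ) →
        (∀ i ∈ A, S i ⊆ PorousTube.latticeBall (2 * N)) →
        (∀ κ : ℝ, 0 < κ →
          (∀ i ∈ A, ∀ j ∈ A, i ≠ j →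
            ENNReal.ofReal ((|(i : ℝ) - (j : ℝ)| - δ) * N / P) ≤ PorousTube.setDist (S i) (S j)) →
          (∀ i ∈ A, ENNReal.ofReal κ ≤ PorousTube.capN N (S i)) →
          ((ENNReal.ofReal (c₂ * κ * P))⁻¹
              + ENNReal.ofReal (1 + ε) * (PorousTube.capBrownian PorousTube.unitSegment)⁻¹)⁻¹
            ≤ PorousTube.capN N (⋃ i ∈ A, S i)) ∧
        ((∀ i ∈ A, ∀ j ∈ A, ∀ x₁ ∈ S i, ∀ x₂ ∈ S j,
            PorousTube.eucl x₁ x₂ ≤ (|(i : ℝ) - (j : ℝ)| + 1 / δ) * N / P) →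
          PorousTube.capN N (⋃ i ∈ A, S i) ≤ ENNReal.ofReal (1 + ε) * PorousTube.capBrownian PorousTube.unitSegment) := by
  obtain ⟨c₁, hc₁, c₂, hc₂, C, hC, hlow⟩ := PorousTube.exists_le_capN_iUnion hε hδ
  obtain ⟨C', hC', hup⟩ := PorousTube.exists_capN_iUnion_le hε hδ
  refine ⟨c₁, hc₁, c₂, hc₂, C + C', by positivity,
    fun N P A S _ hP hPN hA hcard hS => ⟨fun κ hκ hfar hcap => ?_, fun hclose => ?_⟩⟩
  · exact hlow N P A S κ (by linarith) hPN hA hcard hS hκ hfar hcap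
  · exact hup N P A S (by linarith) hPN hA hS hclose
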